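/- Let $d=s+1\ge 2$ be even, $m>0$, and write $p\cdot q=p^0q^0-\sum_{j=1}^{s}p^jq^j$ for the Minkowski product on $\mathbb R^d$. **Test functions.** Let $\mathscr S_0=\mathbb C$, $\mathscr S_n=\mathscr S(\mathbb R^{nd})$, and $\underline{\mathscr S}=\bigoplus_{n\ge0}\mathscr S_n$ with the product $(f\otimes g)_n(x_1,\dots,x_n)=\sum_{k=0}^n f_k(x_1,\dots,x_k)\,g_{n-k}(x_{k+1},\dots,x_n)$. Put $\tilde f_n(p_1,\dots,p_n)=(2\pi)^{-nd/2}\int dx_1\cdots dx_n\,f_n(x_1,\dots,x_n)\,e^{i\sum_k p_k\cdot x_k}$, and for $f_1\in\mathscr S_1$ put $f_1^{\pm}(p)=\tilde f_1(\pm p)$. **Deformation.** Let $R$ be a deformation function: a smooth $R:\mathbb R\to\mathbb C$, all of whose derivatives are polynomially bounded, with $R(a)^{-1}=\overline{R(a)}=R(-a)$ and $R(0)=1$, whose distributional Fourier transform (with kernel $e^{-2\pi i a t}$, up to normalization) is supported in $[0,\infty)$. Let $Q$ be an admissible real $d\times d$ matrix: with $W_0=\{x:x^1>|x^0|\}$,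 $Q$ is antisymmetric with respect to the Minkowski product, $\Lambda Q\Lambda^{-1}=Q$ (resp. $-Q$) for every proper orthochronous (resp. proper antichronous) Lorentz transformation $\Lambda$ with $\Lambda W_0=W_0$, and $Q$ maps the closed forward light cone into $\overline{W_0}$. Let $\rho=\rho(R,Q)$ be the linear bijection of $\underline{\mathscr S}$ given by $\widetilde{(\rho f)}_n(p_1,\dots,p_n)=\prod_{1\le l<r\le n}R(-p_l\cdot Qp_r)\,\tilde f_n(p_1,\dots,p_n)$, and let $f\otimes_\rho g=\rho^{-1}(\rho(f)\otimes\rho(g))$. **Fock space and fields.** Let $d\mu(p)=\varepsilon_{\mathbf p}^{-1}\delta(p^0-\varepsilon_{\mathbf p})\,dp$ with $\varepsilon_{\mathbf p}=\sqrt{\mathbf p^2+m^2}$, and let $\mathcal H$ be the Bose Fock space over $L^2(\mathbb R^d,d\mu)$, with vacuum $\Omega$ and with creation and annihilation distributions $a^\dagger(p),a(p)$, where $(a(q)\Psi)_n(p_1,\dots,p_n)=\sqrt{n+1}\,\Psi_{n+1}(q,p_1,\dots,p_n)$. Let $\phi$ be the free scalar field of mass $m$ on $\mathcal H$, i.e.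 $\phi(f_1)=\int d\mu(p)\,\big(\tilde f_1(p)\,a^\dagger(p)+\tilde f_1(-p)\,a(p)\big)$ for $f_1\in\mathscr S_1$, extended to $\underline{\mathscr S}$ multiplicatively. Let $\Psi(f)=\phi(f)\Omega$ for $f\in\underline{\mathscr S}$, and $\mathcal D=\{\Psi(g):g\in\underline{\mathscr S}\}$. The deformed field operators $\phi_{R,Q}(f)$ are the operators with domain $\mathcal D$ given by $\phi_{R,Q}(f)\Psi(g)=\Psi(f\otimes_\rho g)$, $f,g\in\underline{\mathscr S}$. **Twisted creation and annihilation operators.** For $x\in\mathbb R^d$ let $(T_R(x)\Psi)_n(p_1,\dots,p_n)=\prod_{k=1}^n R(x\cdot p_k)\,\Psi_n(p_1,\dots,p_n)$, and let $a_{R,Q}(p)=a(p)\,T_R(Qp)$; that is, for $\varphi\in L^2(\mathbb R^d,d\mu)$, $a_{R,Q}(\varphi)$ is the operator $$(a_{R,Q}(\varphi)\Psi)_n(p_1,\dots,p_n)=\sqrt{n+1}\int d\mu(q)\,\overline{\varphi(q)}\,(T_R(Qq)\Psi)_{n+1}(q,p_1,\dots,p_n)$$ on the space of finite particle vectors, and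 $a_{R,Q}^\dagger(\varphi)=a_{R,Q}(\varphi)^*$ is its Hilbert space adjoint. **Proposition.** For every $f_1\in\mathscr S_1$, the operator $\phi_{R,Q}(f_1)$ is well defined on $\mathcal D$ by $\phi_{R,Q}(f_1)\Psi(g)=\Psi(f_1\otimes_\rho g)$, the domain $\mathcal D$ is contained in the domains of $a_{R,Q}^\dagger(f_1^+)$ and of $a_{R,Q}(\overline{f_1^-})$, and on $\mathcal D$ $$\phi_{R,Q}(f_1)=a_{R,Q}^\dagger(f_1^+)+a_{R,Q}(\overline{f_1^-}).$$ -/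

import Mathlib

open MeasureTheory SchwartzMap
open scoped SchwartzMap FourierTransform ComplexConjugate ENNReal ContDiff BigOperators

noncomputable section

namespace DeformedField

/-! ### Minkowski space -/

/-- Minkowski space of dimension `d = s + 1`; `x 0` is the time component. -/
abbrev Spacetime (s : ℕ) := EuclideanSpace ℝ (Fin (s + 1))

/-- The Minkowski inner product `x · y`. -/
def mink {s : ℕ} (x y : Spacetime s) : ℝ := x 0 * y 0 - ∑ i : Fin s, x i.succ * y i.succ

/-- The action of a matrix on Minkowski space. -/
def act {s : ℕ} (Q : Matrix (Fin (s + 1)) (Fin (s + 1)) ℝ) (x : Spacetime s) : Spacetime s :=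
  Matrix.toEuclideanCLM (𝕜 := ℝ) Q x

/-- The right wedge `W₀ = {x : x¹ > |x⁰|}`. -/
def rightWedge (s : ℕ) : Set (Spacetime s) := {x | |x 0| < x 1}

/-- The closed forward light cone. -/
def closedForwardCone (s : ℕ) : Set (Spacetime s) := {q | 0 ≤ mink q q ∧ 0 ≤ q 0}

/-- Proper Lorentz transformations. -/
def IsProperLorentz {s : ℕ} (L : Matrix (Fin (s + 1)) (Fin (s + 1)) ℝ) : Prop :=
  (∀ x y : Spacetime s, mink (act L x) (act L y) = mink x y) ∧ L.det = 1

/-- Admissible matrices: antisymmetric with respect to the Minkowski inner product, with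
`Λ Q Λ⁻¹ = Q` (resp. `-Q`) for all proper orthochronous (resp. proper, time-reversing) Lorentz
transformations `Λ` which preserve the right wedge, and mapping the closed forward light cone into
the closure of the right wedge. -/
structure IsAdmissible {s : ℕ} (Q : Matrix (Fin (s + 1)) (Fin (s + 1)) ℝ) : Prop where
  antisymm : ∀ x y : Spacetime s, mink (act Q x) y = - mink x (act Q y)
  orthochronous : ∀ L : Matrix (Fin (s + 1)) (Fin (s + 1)) ℝ, IsProperLorentz L → 0 < L 0 0 →
    act L '' rightWedge s = rightWedge s → L * Q * L⁻¹ = Q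
  antichronous : ∀ L : Matrix (Fin (s + 1)) (Fin (s + 1)) ℝ, IsProperLorentz L → L 0 0 < 0 →
    act L '' rightWedge s = rightWedge s → L * Q * L⁻¹ = -Q
  cone : ∀ q ∈ closedForwardCone s, act Q q ∈ closure (rightWedge s)

/-! ### Deformation functions -/

/-- Deformation functions: smooth functions `R : ℝ → ℂ`, all of whose derivatives are polynomially
bounded, with `R(a)⁻¹ = conj R(a) = R(-a)`, `R(0) = 1`, and such that the Fourier transform of the
tempered distribution `R` is supported in `[0, ∞)`. -/
structure DeformationFunction where
  toFun : ℝ → ℂ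
  temperate : toFun.HasTemperateGrowth
  mul_conj : ∀ a, toFun a * conj (toFun a) = 1
  conj_eq : ∀ a, conj (toFun a) = toFun (-a)
  map_zero : toFun 0 = 1
  support : Distribution.dsupport
    (𝓕 (Function.HasTemperateGrowth.toTemperedDistribution volume temperate) : 𝓢'(ℝ, ℂ)) ⊆ Set.Ici 0

instance : CoeFun DeformationFunction (fun _ => ℝ → ℂ) := ⟨DeformationFunction.toFun⟩

theorem DeformationFunction.norm_eq (R : DeformationFunction) (a : ℝ) : ‖R a‖ = 1 := by
  have h := congrArg norm (R.mul_conj a)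
  rw [norm_mul, RCLike.norm_conj, norm_one] at h
  nlinarith [norm_nonneg (R a)]

theorem DeformationFunction.mul_neg (R : DeformationFunction) (a : ℝ) : R a * R (-a) = 1 := by
  rw [← R.conj_eq]; exact R.mul_conj a

theorem DeformationFunction.continuous (R : DeformationFunction) : Continuous R :=
  R.temperate.1.continuous

theorem DeformationFunction.hasTemperateGrowth_prod {E ι : Type*} [NormedAddCommGroup E]
    [NormedSpace ℝ E] (R : DeformationFunction) (t : Finset ι) (u : ι → E → ℝ)
    (hu : ∀ i ∈ t, (u i).HasTemperateGrowth) :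
    (fun x => ∏ i ∈ t, R (u i x)).HasTemperateGrowth := by
  classical
  induction t using Finset.induction_on with
  | empty => simp only [Finset.prod_empty]; exact Function.HasTemperateGrowth.const (1 : ℂ)
  | insert a t ha ih =>
    simp only [Finset.prod_insert ha]
    exact (R.temperate.comp (hu a (by simp))).mul (ih fun i hi => hu i (by simp [hi]))

/-! ### The Borchers-Uhlmann algebra -/

/-- The space `ℝ^{nd}` of configurations `(x₁, …, xₙ)` of `n` points of Minkowski space. -/
abbrev Config (s n : ℕ) := EuclideanSpace ℝ (Fin n × Fin (s + 1))

/-- The identification of `ℝ^{nd}` with `n`-tuples of points. -/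
def tuple (s n : ℕ) : Config s n ≃L[ℝ] (Fin n → Spacetime s) :=
  LinearEquiv.toContinuousLinearEquiv
    { toFun := fun x k => WithLp.toLp 2 fun i => x (k, i)
      invFun := fun p => WithLp.toLp 2 fun ki => p ki.1 ki.2
      map_add' := fun _ _ => rfl
      map_smul' := fun _ _ => rfl
      left_inv := fun _ => rfl
      right_inv := fun _ => rfl }

@[simp] theorem tuple_apply {s n : ℕ} (x : Config s n) (k : Fin n) (i : Fin (s + 1)) :
    tuple s n x k i = x (k, i) := rfl

@[simp] theorem tuple_symm_apply {s n : ℕ} (p : Fin n → Spacetime s) (k : Fin n)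
    (i : Fin (s + 1)) : (tuple s n).symm p (k, i) = p k i := rfl

/-- The Schwartz space `𝒮ₙ = 𝒮(ℝ^{nd})` of `n`-point test functions; `𝒮₀` consists of functions on
a one-point space, i.e. of complex numbers. -/
abbrev TestFn (s n : ℕ) := 𝓢(Config s n, ℂ)

/-- The linear space `⨁ₙ 𝒮ₙ` of terminating sequences of test functions. -/
abbrev BUAlgebra (s : ℕ) := DirectSum ℕ fun n => TestFn s n

/-- The function `x ↦ f (A x) * g (B x)` as a Schwartz function, for linear maps `A, B` which are
jointly bounded below. -/
def schwartzMul {D E F : Type} [NormedAddCommGroup D] [NormedSpace ℝ D]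
    [NormedAddCommGroup E] [NormedSpace ℝ E] [NormedAddCommGroup F] [NormedSpace ℝ F]
    (A : D →L[ℝ] E) (B : D →L[ℝ] F) (h : ∀ x, ‖x‖ ≤ ‖A x‖ + ‖B x‖)
    (f : 𝓢(E, ℂ)) (g : 𝓢(F, ℂ)) : 𝓢(D, ℂ) where
  toFun x := f (A x) * g (B x)
  smooth' := ((f.smooth ⊤).comp A.contDiff).mul ((g.smooth ⊤).comp B.contDiff)
  decay' := by
    intro k n
    have hder : ∀ {G : Type} [NormedAddCommGroup G] [NormedSpace ℝ G] (L : D →L[ℝ] G)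
        (u : 𝓢(G, ℂ)) (i : ℕ) (x : D),
        ‖iteratedFDeriv ℝ i (fun x => u (L x)) x‖ ≤ ‖L‖ ^ i * ‖iteratedFDeriv ℝ i u (L x)‖ := by
      intro G _ _ L u i x
      have := L.iteratedFDeriv_comp_right (f := u) (u.smooth ⊤) x (i := i) (by exact_mod_cast le_top)
      have h2 : (fun x => u (L x)) = u ∘ L := rfl
      rw [h2, this]
      refine (ContinuousMultilinearMap.norm_compContinuousLinearMap_le _ _).trans ?_
      simp [mul_comm]
    refine ⟨∑ i ∈ Finset.range (n + 1), (n.choose i : ℝ) * (2 ^ (k - 1) *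
      ((‖A‖ ^ i * SchwartzMap.seminorm ℝ k i f) * (‖B‖ ^ (n - i) * SchwartzMap.seminorm ℝ 0 (n - i) g)
      + (‖A‖ ^ i * SchwartzMap.seminorm ℝ 0 i f) *
        (‖B‖ ^ (n - i) * SchwartzMap.seminorm ℝ k (n - i) g))), fun x => ?_⟩
    have h1 := norm_iteratedFDeriv_mul_le (n := n) (N := ∞) (f := fun x => f (A x))
      (g := fun x => g (B x)) ((f.smooth ⊤).comp A.contDiff) ((g.smooth ⊤).comp B.contDiff)
      x (by exact_mod_cast le_top)
    refine (mul_le_mul_of_nonneg_left h1 (by positivity)).trans ?_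
    rw [Finset.mul_sum]
    refine Finset.sum_le_sum fun i _ => ?_
    have hx : ‖x‖ ^ k ≤ 2 ^ (k - 1) * (‖A x‖ ^ k + ‖B x‖ ^ k) :=
      (pow_le_pow_left₀ (norm_nonneg _) (h x) k).trans
        (add_pow_le (norm_nonneg _) (norm_nonneg _) k)
    have fk := f.le_seminorm ℝ k i (A x)
    have f0 := f.le_seminorm ℝ 0 i (A x)
    have gk := g.le_seminorm ℝ k (n - i) (B x)
    have g0 := g.le_seminorm ℝ 0 (n - i) (B x)
    simp only [pow_zero, one_mul] at f0 g0
    have df := hder A f i x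
    have dg := hder B g (n - i) x
    set a := ‖iteratedFDeriv ℝ i f (A x)‖
    set b := ‖iteratedFDeriv ℝ (n - i) g (B x)‖
    have ha : 0 ≤ a := norm_nonneg _
    have hb : 0 ≤ b := norm_nonneg _
    calc ‖x‖ ^ k * ((n.choose i : ℝ) * ‖iteratedFDeriv ℝ i (fun x => f (A x)) x‖ *
          ‖iteratedFDeriv ℝ (n - i) (fun x => g (B x)) x‖)
        ≤ (2 ^ (k - 1) * (‖A x‖ ^ k + ‖B x‖ ^ k)) *
          ((n.choose i : ℝ) * (‖A‖ ^ i * a) * (‖B‖ ^ (n - i) * b)) := by gcongr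
      _ = (n.choose i : ℝ) * (2 ^ (k - 1) *
          ((‖A‖ ^ i * (‖A x‖ ^ k * a)) * (‖B‖ ^ (n - i) * b) +
            (‖A‖ ^ i * a) * (‖B‖ ^ (n - i) * (‖B x‖ ^ k * b)))) := by ring
      _ ≤ _ := by gcongr

/-- The projection of a configuration of `k + l` points to the first `k` points. -/
def firstPts (s k l : ℕ) : Config s (k + l) →L[ℝ] Config s k :=
  LinearMap.toContinuousLinearMap
    { toFun := fun x => WithLp.toLp 2 fun a => x (Fin.castAdd l a.1, a.2)
      map_add' := fun _ _ => rfl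
      map_smul' := fun _ _ => rfl }

/-- The projection of a configuration of `k + l` points to the last `l` points. -/
def lastPts (s k l : ℕ) : Config s (k + l) →L[ℝ] Config s l :=
  LinearMap.toContinuousLinearMap
    { toFun := fun x => WithLp.toLp 2 fun a => x (Fin.natAdd k a.1, a.2)
      map_add' := fun _ _ => rfl
      map_smul' := fun _ _ => rfl }

theorem norm_le_pts (s k l : ℕ) (x : Config s (k + l)) :
    ‖x‖ ≤ ‖firstPts s k l x‖ + ‖lastPts s k l x‖ := by
  have h : ‖x‖ ^ 2 = ‖firstPts s k l x‖ ^ 2 + ‖lastPts s k l x‖ ^ 2 := by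
    simp only [EuclideanSpace.norm_sq_eq, Fintype.sum_prod_type, Fin.sum_univ_add]
    rfl
  refine abs_le_of_sq_le_sq' ?_ (by positivity) |>.2
  rw [h]
  nlinarith [norm_nonneg (firstPts s k l x), norm_nonneg (lastPts s k l x)]

/-- The tensor product
`(f ⊗ g)(x₁, …, x_{k+l}) = f(x₁, …, x_k) g(x_{k+1}, …, x_{k+l})` of test functions. -/
def tensor (s k l : ℕ) : TestFn s k →ₗ[ℂ] TestFn s l →ₗ[ℂ] TestFn s (k + l) :=
  LinearMap.mk₂ ℂ (schwartzMul (firstPts s k l) (lastPts s k l) (norm_le_pts s k l))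
    (fun f f' g => by ext x; exact add_mul _ _ _)
    (fun c f g => by ext x; exact mul_assoc _ _ _)
    (fun f g g' => by ext x; exact mul_add _ _ _)
    (fun c f g => by ext x; exact mul_left_comm _ _ _)

theorem tensor_apply {s k l : ℕ} (f : TestFn s k) (g : TestFn s l) (x : Config s (k + l)) :
    tensor s k l f g x = f (firstPts s k l x) * g (lastPts s k l x) := rfl

/-- The product `(f ⊗ g)ₙ = ∑ₖ fₖ ⊗ gₙ₋ₖ` of the Borchers-Uhlmann algebra. -/
def buMul (s : ℕ) : BUAlgebra s →ₗ[ℂ] BUAlgebra s →ₗ[ℂ] BUAlgebra s :=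
  DirectSum.toModule ℂ ℕ _ fun k => LinearMap.flip <|
    DirectSum.toModule ℂ ℕ _ fun l => LinearMap.flip <|
      (tensor s k l).compr₂ (DirectSum.lof ℂ ℕ (fun n => TestFn s n) (k + l))

theorem buMul_lof {s k l : ℕ} (f : TestFn s k) (g : TestFn s l) :
    buMul s (DirectSum.lof ℂ ℕ (fun n => TestFn s n) k f)
      (DirectSum.lof ℂ ℕ (fun n => TestFn s n) l g) =
      DirectSum.lof ℂ ℕ (fun n => TestFn s n) (k + l) (tensor s k l f g) := by
  simp [buMul]

/-! ### Fourier transform and deformed product -/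

/-- Reflection of the space coordinates of all points of a configuration. -/
def spaceReflection (s n : ℕ) : Config s n ≃L[ℝ] Config s n :=
  LinearEquiv.toContinuousLinearEquiv
    { toFun := fun x => WithLp.toLp 2 fun ki => if ki.2 = 0 then x ki else - x ki
      invFun := fun x => WithLp.toLp 2 fun ki => if ki.2 = 0 then x ki else - x ki
      map_add' := fun x y => by
        ext ki; by_cases h : ki.2 = 0 <;> simp [h, add_comm]
      map_smul' := fun c x => by
        ext ki; by_cases h : ki.2 = 0 <;> simp [h]
      left_inv := fun x => by
        ext ki; by_cases h : ki.2 = 0 <;> simp [h]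
      right_inv := fun x => by
        ext ki; by_cases h : ki.2 = 0 <;> simp [h] }

/-- The linear map relating momenta to the frequencies of the standard Fourier transform
`𝓕 f(w) = ∫ f(x) exp(-2πi⟨x, w⟩) dx`. -/
def frequency (s n : ℕ) : Config s n ≃L[ℝ] Config s n :=
  (spaceReflection s n).trans (ContinuousLinearEquiv.smulLeft
    (Units.mk0 (-(2 * Real.pi)⁻¹) (by simp [Real.pi_ne_zero])))

/-- The normalization `(2π)^{-nd/2}`. -/
def fourierNorm (s n : ℕ) : ℝ := (2 * Real.pi) ^ (-((n * (s + 1) : ℕ) : ℝ) / 2)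

theorem fourierNorm_pos (s n : ℕ) : 0 < fourierNorm s n :=
  Real.rpow_pos_of_pos (by positivity) _

/-- The Fourier transform of `n`-point test functions, see `momentum_apply`. -/
def momentum (s n : ℕ) : TestFn s n ≃ₗ[ℂ] TestFn s n where
  toFun f := (fourierNorm s n : ℂ) • compCLMOfContinuousLinearEquiv ℂ (frequency s n) (𝓕 f)
  invFun g := 𝓕⁻ (compCLMOfContinuousLinearEquiv ℂ (frequency s n).symm
    ((fourierNorm s n : ℂ)⁻¹ • g))
  map_add' f g := by simp [FourierTransform.fourier_add]
  map_smul' c f := by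
    simp [FourierTransform.fourier_smul, smul_comm c]
  left_inv f := by
    have h : (fourierNorm s n : ℂ) ≠ 0 := by exact_mod_cast (fourierNorm_pos s n).ne'
    have h2 : ∀ g : TestFn s n, compCLMOfContinuousLinearEquiv ℂ (frequency s n).symm
        (compCLMOfContinuousLinearEquiv ℂ (frequency s n) g) = g := fun g => by ext x; simp
    simp only [h2, smul_smul, inv_mul_cancel₀ h, one_smul,
      FourierTransform.fourierInv_fourier_eq]
  right_inv f := by
    have h : (fourierNorm s n : ℂ) ≠ 0 := by exact_mod_cast (fourierNorm_pos s n).ne'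
    have h2 : ∀ g : TestFn s n, compCLMOfContinuousLinearEquiv ℂ (frequency s n)
        (compCLMOfContinuousLinearEquiv ℂ (frequency s n).symm g) = g := fun g => by ext x; simp
    simp only [FourierTransform.fourier_fourierInv_eq, map_smul, h2, smul_smul, mul_inv_cancel₀ h,
      one_smul]

/-- `f̃(p₁, …, pₙ) = (2π)^{-nd/2} ∫ f(x₁, …, xₙ) exp(i p₁·x₁) ⋯ exp(i pₙ·xₙ) dx₁ ⋯ dxₙ`. -/
theorem momentum_apply {s n : ℕ} (f : TestFn s n) (p : Config s n) :
    momentum s n f p = ((2 * Real.pi) ^ (-((n * (s + 1) : ℕ) : ℝ) / 2) : ℝ) *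
      ∫ x : Config s n, f x * ∏ k, Complex.exp (Complex.I * mink (tuple s n p k) (tuple s n x k)) := by
  change (fourierNorm s n : ℂ) * (𝓕 f) (frequency s n p) = _
  rw [SchwartzMap.fourier_coe, Real.fourier_eq']
  congr 1
  refine integral_congr_ae (Filter.Eventually.of_forall fun x => ?_)
  simp only [smul_eq_mul]
  rw [mul_comm, ← Complex.exp_sum]
  congr 2
  have h : inner ℝ x (frequency s n p) =
      -(2 * Real.pi)⁻¹ * ∑ k, mink (tuple s n p k) (tuple s n x k) := by
    have h1 : frequency s n p = (-(2 * Real.pi)⁻¹) • spaceReflection s n p := rfl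
    rw [h1, inner_smul_right, PiLp.inner_apply, Fintype.sum_prod_type]
    congr 1
    refine Finset.sum_congr rfl fun k _ => ?_
    rw [Fin.sum_univ_succ]
    simp [spaceReflection, mink, sub_eq_add_neg]
  rw [h]
  push_cast
  rw [← Finset.mul_sum]
  have : (Real.pi : ℂ) ≠ 0 := by exact_mod_cast Real.pi_ne_zero
  field_simp

theorem hasTemperateGrowth_mink {s : ℕ} {E : Type*} [NormedAddCommGroup E] [NormedSpace ℝ E]
    (A B : E →L[ℝ] Spacetime s) : (fun x => mink (A x) (B x)).HasTemperateGrowth := by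
  have h : ∀ (L : E →L[ℝ] Spacetime s) (i : Fin (s + 1)),
      (fun x => L x i).HasTemperateGrowth := fun L i =>
    ((EuclideanSpace.proj i : Spacetime s →L[ℝ] ℝ).comp L).hasTemperateGrowth
  unfold mink
  exact ((h A 0).mul (h B 0)).sub
    (Function.HasTemperateGrowth.sum fun i _ => (h A i.succ).mul (h B i.succ))

/-- The two-point function `ρ₂(p, q) = R(-p·Qq)`. -/
def rhoTwo {s : ℕ} (R : DeformationFunction) (Q : Matrix (Fin (s + 1)) (Fin (s + 1)) ℝ)
    (p q : Spacetime s) : ℂ := R (-mink p (act Q q))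

/-- The `n`-point functions `ρₙ(p₁, …, pₙ) = ∏_{l < r} ρ₂(p_l, p_r)`. -/
def rhoFn {s : ℕ} (R : DeformationFunction) (Q : Matrix (Fin (s + 1)) (Fin (s + 1)) ℝ) (n : ℕ)
    (p : Config s n) : ℂ :=
  ∏ lr : Fin n × Fin n with lr.1 < lr.2, rhoTwo R Q (tuple s n p lr.1) (tuple s n p lr.2)

theorem rhoFn_ne_zero {s : ℕ} (R : DeformationFunction)
    (Q : Matrix (Fin (s + 1)) (Fin (s + 1)) ℝ) (n : ℕ) (p : Config s n) : rhoFn R Q n p ≠ 0 :=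
  Finset.prod_ne_zero_iff.2 fun _ _ => left_ne_zero_of_mul_eq_one (R.mul_neg _)

theorem hasTemperateGrowth_pair {s n : ℕ} (Q : Matrix (Fin (s + 1)) (Fin (s + 1)) ℝ)
    (l r : Fin n) :
    (fun p : Config s n => mink (tuple s n p l) (act Q (tuple s n p r))).HasTemperateGrowth := by
  have h (k : Fin n) : ∃ A : Config s n →L[ℝ] Spacetime s, ∀ p, A p = tuple s n p k :=
    ⟨(ContinuousLinearMap.proj (R := ℝ) (φ := fun _ : Fin n => Spacetime s) k).comp
      (tuple s n).toContinuousLinearMap, fun _ => rfl⟩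
  obtain ⟨A, hA⟩ := h l
  obtain ⟨B, hB⟩ := h r
  have := hasTemperateGrowth_mink A ((Matrix.toEuclideanCLM (𝕜 := ℝ) Q).comp B)
  simp only [ContinuousLinearMap.comp_apply, hA, hB] at this
  exact this

theorem hasTemperateGrowth_rhoFn {s : ℕ} (R : DeformationFunction)
    (Q : Matrix (Fin (s + 1)) (Fin (s + 1)) ℝ) (n : ℕ) :
    (rhoFn R Q n).HasTemperateGrowth :=
  R.hasTemperateGrowth_prod _ _ fun lr _ => (hasTemperateGrowth_pair Q lr.1 lr.2).neg

theorem hasTemperateGrowth_rhoFn_inv {s : ℕ} (R : DeformationFunction)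
    (Q : Matrix (Fin (s + 1)) (Fin (s + 1)) ℝ) (n : ℕ) :
    (fun p => (rhoFn R Q n p)⁻¹).HasTemperateGrowth := by
  have h : (fun p => (rhoFn R Q n p)⁻¹) = fun p => ∏ lr : Fin n × Fin n with lr.1 < lr.2,
      R (mink (tuple s n p lr.1) (act Q (tuple s n p lr.2))) := by
    funext p
    rw [rhoFn, ← Finset.prod_inv_distrib]
    refine Finset.prod_congr rfl fun lr _ => ?_
    rw [rhoTwo, inv_eq_iff_eq_inv]
    exact eq_inv_of_mul_eq_one_right (R.mul_neg _)
  rw [h]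
  exact R.hasTemperateGrowth_prod _ _ fun lr _ => hasTemperateGrowth_pair Q lr.1 lr.2

/-- Multiplication by `ρₙ` on `𝒮ₙ`. -/
def rhoMul {s : ℕ} (R : DeformationFunction) (Q : Matrix (Fin (s + 1)) (Fin (s + 1)) ℝ) (n : ℕ) :
    TestFn s n ≃ₗ[ℂ] TestFn s n where
  toFun := smulLeftCLM ℂ (rhoFn R Q n)
  invFun := smulLeftCLM ℂ fun p => (rhoFn R Q n p)⁻¹
  map_add' := map_add _
  map_smul' := map_smul _
  left_inv f := by
    ext p
    rw [smulLeftCLM_apply_apply (hasTemperateGrowth_rhoFn_inv R Q n),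
      smulLeftCLM_apply_apply (hasTemperateGrowth_rhoFn R Q n), smul_smul,
      inv_mul_cancel₀ (rhoFn_ne_zero R Q n p), one_smul]
  right_inv f := by
    ext p
    rw [smulLeftCLM_apply_apply (hasTemperateGrowth_rhoFn R Q n),
      smulLeftCLM_apply_apply (hasTemperateGrowth_rhoFn_inv R Q n), smul_smul,
      mul_inv_cancel₀ (rhoFn_ne_zero R Q n p), one_smul]

/-- The multiplicative deformation map `ρ = ρ(R, Q)`, which multiplies the momentum space
`n`-point functions by `ρₙ`. -/
def deformationMap {s : ℕ} (R : DeformationFunction) (Q : Matrix (Fin (s + 1)) (Fin (s + 1)) ℝ) :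
    BUAlgebra s ≃ₗ[ℂ] BUAlgebra s :=
  DFinsupp.mapRange.linearEquiv fun n =>
    ((momentum s n).trans (rhoMul R Q n)).trans (momentum s n).symm

theorem momentum_deformationMap {s : ℕ} (R : DeformationFunction)
    (Q : Matrix (Fin (s + 1)) (Fin (s + 1)) ℝ) (f : BUAlgebra s) (n : ℕ) (p : Config s n) :
    momentum s n (deformationMap R Q f n) p = rhoFn R Q n p * momentum s n (f n) p := by
  have h : deformationMap R Q f n =
    (momentum s n).symm (rhoMul R Q n (momentum s n (f n))) := rfl
  rw [h, LinearEquiv.apply_symm_apply]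
  exact smulLeftCLM_apply_apply (hasTemperateGrowth_rhoFn R Q n) _ _

/-- The deformed product `f ⊗_ρ g = ρ⁻¹(ρ(f) ⊗ ρ(g))`. -/
def deformedMul {s : ℕ} (R : DeformationFunction) (Q : Matrix (Fin (s + 1)) (Fin (s + 1)) ℝ) :
    BUAlgebra s →ₗ[ℂ] BUAlgebra s →ₗ[ℂ] BUAlgebra s :=
  ((buMul s).compl₁₂ (deformationMap R Q).toLinearMap (deformationMap R Q).toLinearMap).compr₂
    (deformationMap R Q).symm.toLinearMap

theorem deformedMul_apply {s : ℕ} (R : DeformationFunction)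
    (Q : Matrix (Fin (s + 1)) (Fin (s + 1)) ℝ) (f g : BUAlgebra s) :
    deformedMul R Q f g = (deformationMap R Q).symm
      (buMul s (deformationMap R Q f) (deformationMap R Q g)) := rfl

/-! ### Mass shell and Fock space -/

/-- The energy `ε(k) = √(k² + m²)`. -/
def energy {s : ℕ} (m : ℝ) (k : EuclideanSpace ℝ (Fin s)) : ℝ := √(‖k‖ ^ 2 + m ^ 2)

/-- The point `(ε(k), k)` of the upper mass shell. -/
def shellPoint {s : ℕ} (m : ℝ) (k : EuclideanSpace ℝ (Fin s)) : Spacetime s :=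
  WithLp.toLp 2 (Fin.cons (energy m k) k)

/-- The measure `dμ(p) = ε(𝐩)⁻¹ δ(p⁰ - ε(𝐩)) dp` on Minkowski space. -/
def shellMeasure (s : ℕ) (m : ℝ) : Measure (Spacetime s) :=
  ((volume : Measure (EuclideanSpace ℝ (Fin s))).withDensity
    fun k => ENNReal.ofReal (energy m k)⁻¹).map (shellPoint m)

theorem continuous_energy {s : ℕ} (m : ℝ) : Continuous (energy (s := s) m) := by
  unfold energy; fun_prop

theorem continuous_shellPoint {s : ℕ} (m : ℝ) : Continuous (shellPoint (s := s) m) := by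
  refine (PiLp.continuous_toLp 2 _).comp (continuous_pi fun i => ?_)
  refine Fin.cases ?_ (fun j => ?_) i
  · simpa using continuous_energy m
  · simpa using (EuclideanSpace.proj j : EuclideanSpace ℝ (Fin s) →L[ℝ] ℝ).continuous

theorem norm_le_shellPoint {s : ℕ} (m : ℝ) (k : EuclideanSpace ℝ (Fin s)) :
    ‖k‖ ≤ ‖shellPoint m k‖ := by
  refine abs_le_of_sq_le_sq' ?_ (norm_nonneg _) |>.2
  rw [EuclideanSpace.norm_sq_eq, EuclideanSpace.norm_sq_eq, Fin.sum_univ_succ]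
  simp [shellPoint]
  positivity

instance shellMeasure.hasTemperateGrowth (s : ℕ) (m : ℝ) [hm : Fact (0 < m)] :
    (shellMeasure s m).HasTemperateGrowth := by
  have hm := hm.out
  let ν : Measure (EuclideanSpace ℝ (Fin s)) := volume
  refine ⟨ν.integrablePower, ?_⟩
  have hmeas : Measurable (shellPoint (s := s) m) := (continuous_shellPoint m).measurable
  have hc : Continuous fun x : Spacetime s => (1 + ‖x‖) ^ (-(ν.integrablePower : ℝ)) :=
    Continuous.rpow_const (by fun_prop) fun x => Or.inl (by positivity)
  rw [shellMeasure, integrable_map_measure hc.aestronglyMeasurable hmeas.aemeasurable]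
  have hle : ν.withDensity (fun k => ENNReal.ofReal (energy m k)⁻¹) ≤ ENNReal.ofReal m⁻¹ • ν := by
    rw [← withDensity_const]
    refine withDensity_mono (Filter.Eventually.of_forall fun k => ENNReal.ofReal_le_ofReal ?_)
    refine inv_anti₀ hm (Real.le_sqrt_of_sq_le ?_)
    nlinarith [sq_nonneg ‖k‖]
  have hi : Integrable (fun k => (1 + ‖k‖) ^ (-(ν.integrablePower : ℝ)))
      (ENNReal.ofReal m⁻¹ • ν) :=
    (ν.integrable_pow_neg_integrablePower).smul_measure ENNReal.ofReal_ne_top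
  refine (hi.mono_measure hle).mono (hc.comp (continuous_shellPoint m)).aestronglyMeasurable
    (Filter.Eventually.of_forall fun k => ?_)
  simp only [Function.comp_apply]
  rw [Real.norm_of_nonneg (by positivity), Real.norm_of_nonneg (by positivity)]
  exact Real.rpow_le_rpow_of_nonpos (by positivity) (by gcongr; exact norm_le_shellPoint m k)
    (by simp)

instance shellMeasure.sigmaFinite (s : ℕ) (m : ℝ) : SigmaFinite (shellMeasure s m) := by
  have hmeas : Measurable (shellPoint (s := s) m) := (continuous_shellPoint m).measurable
  have : SigmaFinite ((volume : Measure (EuclideanSpace ℝ (Fin s))).withDensity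
      fun k => ENNReal.ofReal (energy m k)⁻¹) := inferInstance
  refine ((continuous_shellPoint m).measurableEmbedding fun k l h => ?_).sigmaFinite_map
  ext i
  simpa [shellPoint] using congrArg (fun x : Spacetime s => x i.succ) h

/-- The `n`-fold product measure `dμ(p₁) ⋯ dμ(pₙ)`. -/
abbrev shellPi (s : ℕ) (m : ℝ) (n : ℕ) : Measure (Fin n → Spacetime s) :=
  Measure.pi fun _ => shellMeasure s m

theorem measurePreserving_perm (s : ℕ) (m : ℝ) {n : ℕ} (σ : Equiv.Perm (Fin n)) :
    MeasurePreserving (fun p : Fin n → Spacetime s => p ∘ σ) (shellPi s m n) (shellPi s m n) := by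
  convert! measurePreserving_piCongrLeft (fun _ : Fin n => shellMeasure s m) σ.symm using 1
  funext p k
  have h := MeasurableEquiv.piCongrLeft_apply_apply (β := fun _ : Fin n => Spacetime s)
    σ.symm p (σ k)
  rw [Equiv.symm_apply_apply] at h
  exact h.symm

/-- The `n`-particle space: the totally symmetric functions in `L²(dμ(p₁) ⋯ dμ(pₙ))`. -/
def nParticle (s : ℕ) (m : ℝ) (n : ℕ) : Submodule ℂ (Lp ℂ 2 (shellPi s m n)) where
  carrier := {F | ∀ σ : Equiv.Perm (Fin n), (fun p => F (p ∘ σ)) =ᵐ[shellPi s m n] F}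
  zero_mem' σ := by
    have h := Lp.coeFn_zero ℂ 2 (shellPi s m n)
    exact ((measurePreserving_perm s m σ).quasiMeasurePreserving.ae_eq_comp h).trans h.symm
  add_mem' {F G} hF hG σ := by
    have h := Lp.coeFn_add F G
    refine ((measurePreserving_perm s m σ).quasiMeasurePreserving.ae_eq_comp h).trans ?_
    filter_upwards [hF σ, hG σ, h] with p h1 h2 h3
    simp only [Function.comp_apply, Pi.add_apply] at *
    rw [h3, h1, h2]
  smul_mem' c F hF σ := by
    have h := Lp.coeFn_smul c F
    refine ((measurePreserving_perm s m σ).quasiMeasurePreserving.ae_eq_comp h).trans ?_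
    filter_upwards [hF σ, h] with p h1 h3
    simp only [Function.comp_apply, Pi.smul_apply] at *
    rw [h3, h1]

instance nParticle.completeSpace (s : ℕ) (m : ℝ) (n : ℕ) : CompleteSpace (nParticle s m n) := by
  have h : (nParticle s m n : Set (Lp ℂ 2 (shellPi s m n))) =
      ⋂ σ : Equiv.Perm (Fin n),
        {F | Lp.compMeasurePreserving _ (measurePreserving_perm s m σ) F = F} := by
    ext F
    simp only [Set.mem_iInter]
    refine forall_congr' fun σ => ?_
    have hc := Lp.coeFn_compMeasurePreserving F (measurePreserving_perm s m σ)
    refine ⟨fun hF => Lp.ext (hc.trans hF), fun hF => ?_⟩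
    have hF' : Lp.compMeasurePreserving _ (measurePreserving_perm s m σ) F = F := hF
    rw [hF'] at hc
    exact hc.symm
  have hcl : IsClosed (nParticle s m n : Set (Lp ℂ 2 (shellPi s m n))) := by
    rw [h]
    exact isClosed_iInter fun σ => isClosed_eq
      (Lp.isometry_compMeasurePreserving (measurePreserving_perm s m σ)).continuous continuous_id
  exact hcl.completeSpace_coe

/-- The Bose Fock space over `L²(dμ)`. -/
abbrev Fock (s : ℕ) (m : ℝ) := lp (fun n => nParticle s m n) 2

/-- The finite particle vectors. -/
def finiteParticle (s : ℕ) (m : ℝ) : Submodule ℂ (Fock s m) where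
  carrier := {Ψ | ∃ N, ∀ n, N < n → Ψ n = 0}
  zero_mem' := ⟨0, fun _ _ => rfl⟩
  add_mem' := by
    rintro Ψ Φ ⟨N, hN⟩ ⟨M, hM⟩
    refine ⟨max N M, fun n hn => ?_⟩
    rw [lp.coeFn_add, Pi.add_apply, hN n (lt_of_le_of_lt (le_max_left _ _) hn),
      hM n (lt_of_le_of_lt (le_max_right _ _) hn), add_zero]
  smul_mem' := by
    rintro c Ψ ⟨N, hN⟩
    exact ⟨N, fun n hn => by rw [lp.coeFn_smul, Pi.smul_apply, hN n hn, smul_zero]⟩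

/-! ### Creation and annihilation operators -/

/-- The operator `∫ dμ(q) a(q) G(q)` on a `q`-dependent sequence `G(q)` of `n`-particle functions,
where `(a(q)Ψ)ₙ(p₁, …, pₙ) = √(n+1) Ψₙ₊₁(q, p₁, …, pₙ)`. -/
def annihInt {s : ℕ} (m : ℝ) (G : Spacetime s → ∀ n, (Fin n → Spacetime s) → ℂ) (n : ℕ)
    (p : Fin n → Spacetime s) : ℂ :=
  (√(n + 1 : ℝ) : ℂ) * ∫ q, G q (n + 1) (Fin.cons q p) ∂shellMeasure s m

/-- The operator `∫ dμ(q) a†(q) G(q)` on a `q`-dependent sequence `G(q)` of `n`-particle functions: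
its `(n+1)`-particle function is
`(n+1)^{-1/2} ∑ₖ G(pₖ)ₙ(p₁, …, pₖ₋₁, pₖ₊₁, …, pₙ₊₁)`. -/
def creatInt {s : ℕ} (G : Spacetime s → ∀ n, (Fin n → Spacetime s) → ℂ) :
    ∀ n, (Fin n → Spacetime s) → ℂ
  | 0, _ => 0
  | n + 1, p => ((√(n + 1 : ℝ))⁻¹ : ℂ) * ∑ k, G (p k) n (fun i => p (k.succAbove i))

/-- `(T_R(x)Ψ)ₙ(p₁, …, pₙ) = ∏ₖ R(x·pₖ) Ψₙ(p₁, …, pₙ)`. -/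
def twist {s : ℕ} (R : DeformationFunction) (x : Spacetime s)
    (Ψ : ∀ n, (Fin n → Spacetime s) → ℂ) (n : ℕ) (p : Fin n → Spacetime s) : ℂ :=
  (∏ k, R (mink x (p k))) * Ψ n p

/-- The action of `a_{R,Q}(φ) = ∫ dμ(q) conj φ(q) a(q) T_R(Qq)` on sequences of `n`-particle
functions. -/
def twistedAnnihFn {s : ℕ} (m : ℝ) (R : DeformationFunction)
    (Q : Matrix (Fin (s + 1)) (Fin (s + 1)) ℝ) (φ : Spacetime s → ℂ)
    (Ψ : ∀ n, (Fin n → Spacetime s) → ℂ) : ∀ n, (Fin n → Spacetime s) → ℂ :=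
  annihInt m fun q n p => conj (φ q) * twist R (act Q q) Ψ n p

theorem memLp_integral_mul {X Y : Type*} [MeasurableSpace X] [MeasurableSpace Y]
    {μ : Measure X} {ν : Measure Y} [SFinite μ] [SFinite ν] {φ : X → ℂ} (hφ : MemLp φ 2 μ)
    {G : X × Y → ℂ} (hG : MemLp G 2 (μ.prod ν)) :
    MemLp (fun y => ∫ x, φ x * G (x, y) ∂μ) 2 ν ∧
      ∀ᵐ y ∂ν, Integrable (fun x => φ x * G (x, y)) μ := by
  have hG2 := (memLp_two_iff_integrable_sq_norm hG.1).1 hG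
  have hφ2 := (memLp_two_iff_integrable_sq_norm hφ.1).1 hφ
  have hsl : ∀ᵐ y ∂ν, MemLp (fun x => G (x, y)) 2 μ := by
    have hswap : AEStronglyMeasurable (fun z : Y × X => G z.swap) (ν.prod μ) := hG.1.prod_swap
    filter_upwards [hG2.prod_left_ae, hswap.prodMk_left] with y h1 h2
    exact (memLp_two_iff_integrable_sq_norm h2).2 h1
  have hint : ∀ᵐ y ∂ν, Integrable (fun x => φ x * G (x, y)) μ := by
    filter_upwards [hsl] with y hy
    exact hφ.integrable_mul hy
  refine ⟨?_, hint⟩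
  have hm : AEStronglyMeasurable (fun y => ∫ x, φ x * G (x, y) ∂μ) ν := by
    have : AEStronglyMeasurable (fun z : Y × X => φ z.2 * G z.swap) (ν.prod μ) :=
      hφ.1.comp_snd.mul hG.1.prod_swap
    exact this.integral_prod_right'
  rw [memLp_two_iff_integrable_sq_norm hm]
  refine (hG2.integral_prod_right.const_mul (∫ x, ‖φ x‖ ^ 2 ∂μ)).mono (hm.norm.pow 2) ?_
  filter_upwards [hsl] with y hy
  have h1 := integral_mul_norm_le_Lp_mul_Lq (μ := μ) Real.HolderConjugate.two_two
    (f := φ) (g := fun x => G (x, y)) (by simpa using hφ) (by simpa using hy)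
  have h2 : ‖∫ x, φ x * G (x, y) ∂μ‖ ≤ ∫ x, ‖φ x‖ * ‖G (x, y)‖ ∂μ := by
    refine (norm_integral_le_integral_norm _).trans (le_of_eq ?_)
    simp only [norm_mul]
  have ha : 0 ≤ ∫ x, ‖φ x‖ ^ 2 ∂μ := integral_nonneg fun _ => by positivity
  have hb : 0 ≤ ∫ x, ‖G (x, y)‖ ^ 2 ∂μ := integral_nonneg fun _ => by positivity
  simp only [Real.rpow_ofNat, ← Real.sqrt_eq_rpow] at h1
  have h3 := pow_le_pow_left₀ (norm_nonneg _) (h2.trans h1) 2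
  rw [mul_pow, Real.sq_sqrt ha, Real.sq_sqrt hb] at h3
  rw [Real.norm_of_nonneg (by positivity), Real.norm_of_nonneg (by positivity)]
  exact h3

theorem measurePreserving_cons (s : ℕ) (m : ℝ) (n : ℕ) :
    MeasurePreserving (fun z : Spacetime s × (Fin n → Spacetime s) =>
      (Fin.cons z.1 z.2 : Fin (n + 1) → Spacetime s))
      ((shellMeasure s m).prod (shellPi s m n)) (shellPi s m (n + 1)) := by
  have h := (measurePreserving_piFinSuccAbove (fun _ : Fin (n + 1) => shellMeasure s m) 0).symm
  convert! h using 1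
  funext z
  simp [MeasurableEquiv.piFinSuccAbove]
  rfl

theorem continuous_mink {s : ℕ} : Continuous fun z : Spacetime s × Spacetime s => mink z.1 z.2 := by
  unfold mink; fun_prop

theorem continuous_act {s : ℕ} (Q : Matrix (Fin (s + 1)) (Fin (s + 1)) ℝ) : Continuous (act Q) :=
  (Matrix.toEuclideanCLM (𝕜 := ℝ) Q).continuous

/-- The integrand of the twisted annihilation operator, without the test function. -/
theorem memLp_twist {s : ℕ} {m : ℝ} (R : DeformationFunction)
    (Q : Matrix (Fin (s + 1)) (Fin (s + 1)) ℝ) {n : ℕ} {F : (Fin (n + 1) → Spacetime s) → ℂ}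
    (hF : MemLp F 2 (shellPi s m (n + 1))) :
    MemLp (fun z : Spacetime s × (Fin n → Spacetime s) =>
      (∏ k, R (mink (act Q z.1) ((Fin.cons z.1 z.2 : Fin (n + 1) → Spacetime s) k))) *
        F (Fin.cons z.1 z.2)) 2 ((shellMeasure s m).prod (shellPi s m n)) := by
  have h1 : MemLp (fun z : Spacetime s × (Fin n → Spacetime s) => F (Fin.cons z.1 z.2)) 2
      ((shellMeasure s m).prod (shellPi s m n)) :=
    hF.comp_measurePreserving (measurePreserving_cons s m n)
  have hc : Continuous fun z : Spacetime s × (Fin n → Spacetime s) =>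
      ∏ k, R (mink (act Q z.1) ((Fin.cons z.1 z.2 : Fin (n + 1) → Spacetime s) k)) := by
    refine continuous_finsetProd _ fun k _ => R.continuous.comp (continuous_mink.comp
      (((continuous_act Q).comp continuous_fst).prodMk ?_))
    refine Fin.cases ?_ (fun j => ?_) k
    · exact continuous_fst
    · exact (continuous_apply j).comp continuous_snd
  refine h1.of_le (hc.aestronglyMeasurable.mul h1.1) (Filter.Eventually.of_forall fun z => ?_)
  rw [norm_mul, norm_prod, Finset.prod_eq_one fun k _ => R.norm_eq _, one_mul]

theorem ae_cons {s : ℕ} {m : ℝ} {n : ℕ} {P : (Fin (n + 1) → Spacetime s) → Prop}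
    (h : ∀ᵐ p ∂shellPi s m (n + 1), P p) :
    ∀ᵐ p ∂shellPi s m n, ∀ᵐ q ∂shellMeasure s m, P (Fin.cons q p) := by
  have h1 := (measurePreserving_cons s m n).quasiMeasurePreserving.ae h
  have h2 := (Measure.measurePreserving_swap (μ := shellPi s m n)
    (ν := shellMeasure s m)).quasiMeasurePreserving.ae h1
  exact Measure.ae_ae_of_ae_prod h2

theorem twistedAnnihFn_eq {s : ℕ} {m : ℝ} {R : DeformationFunction}
    {Q : Matrix (Fin (s + 1)) (Fin (s + 1)) ℝ} (φ : Spacetime s → ℂ)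
    (Ψ : ∀ n, (Fin n → Spacetime s) → ℂ) (n : ℕ) (p : Fin n → Spacetime s) :
    twistedAnnihFn m R Q φ Ψ n p = (√(n + 1 : ℝ) : ℂ) * ∫ q, conj (φ q) *
      ((∏ k, R (mink (act Q q) ((Fin.cons q p : Fin (n + 1) → Spacetime s) k))) *
        Ψ (n + 1) (Fin.cons q p)) ∂shellMeasure s m := rfl

theorem memLp_conj {X : Type*} [MeasurableSpace X] {μ : Measure X} {φ : X → ℂ}
    (hφ : MemLp φ 2 μ) : MemLp (fun x => conj (φ x)) 2 μ :=
  hφ.star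

theorem memLp_twistedAnnihFn {s : ℕ} {m : ℝ} (R : DeformationFunction)
    (Q : Matrix (Fin (s + 1)) (Fin (s + 1)) ℝ) {φ : Spacetime s → ℂ}
    (hφ : MemLp φ 2 (shellMeasure s m)) {Ψ : ∀ n, (Fin n → Spacetime s) → ℂ} (n : ℕ)
    (hΨ : MemLp (Ψ (n + 1)) 2 (shellPi s m (n + 1))) :
    MemLp (twistedAnnihFn m R Q φ Ψ n) 2 (shellPi s m n) :=
  (memLp_integral_mul (memLp_conj hφ) (memLp_twist R Q hΨ)).1.const_mul _

theorem integrable_twistedAnnihFn {s : ℕ} {m : ℝ} (R : DeformationFunction)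
    (Q : Matrix (Fin (s + 1)) (Fin (s + 1)) ℝ) {φ : Spacetime s → ℂ}
    (hφ : MemLp φ 2 (shellMeasure s m)) {Ψ : ∀ n, (Fin n → Spacetime s) → ℂ} (n : ℕ)
    (hΨ : MemLp (Ψ (n + 1)) 2 (shellPi s m (n + 1))) :
    ∀ᵐ p ∂shellPi s m n, Integrable (fun q => conj (φ q) *
      ((∏ k, R (mink (act Q q) ((Fin.cons q p : Fin (n + 1) → Spacetime s) k))) *
        Ψ (n + 1) (Fin.cons q p))) (shellMeasure s m) :=
  (memLp_integral_mul (memLp_conj hφ) (memLp_twist R Q hΨ)).2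

theorem twistedAnnihFn_congr {s : ℕ} {m : ℝ} {R : DeformationFunction}
    {Q : Matrix (Fin (s + 1)) (Fin (s + 1)) ℝ} (φ : Spacetime s → ℂ)
    {Ψ Φ : ∀ n, (Fin n → Spacetime s) → ℂ} (n : ℕ)
    (h : Ψ (n + 1) =ᵐ[shellPi s m (n + 1)] Φ (n + 1)) :
    twistedAnnihFn m R Q φ Ψ n =ᵐ[shellPi s m n] twistedAnnihFn m R Q φ Φ n := by
  filter_upwards [ae_cons h] with p hp
  rw [twistedAnnihFn_eq, twistedAnnihFn_eq]
  congr 1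
  refine integral_congr_ae ?_
  filter_upwards [hp] with q hq
  rw [hq]

theorem cons_comp_perm {X : Type*} {n : ℕ} (σ : Equiv.Perm (Fin n)) (q : X) (p : Fin n → X) :
    (Fin.cons q (p ∘ σ) : Fin (n + 1) → X) =
      Fin.cons q p ∘ Equiv.Perm.decomposeFin.symm (0, σ) := by
  funext k
  refine Fin.cases ?_ (fun j => ?_) k <;> simp

theorem twistedAnnihFn_symm {s : ℕ} {m : ℝ} {R : DeformationFunction}
    {Q : Matrix (Fin (s + 1)) (Fin (s + 1)) ℝ} (φ : Spacetime s → ℂ)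
    {Ψ : ∀ n, (Fin n → Spacetime s) → ℂ} (n : ℕ)
    (h : ∀ σ : Equiv.Perm (Fin (n + 1)),
      (fun p => Ψ (n + 1) (p ∘ σ)) =ᵐ[shellPi s m (n + 1)] Ψ (n + 1)) (σ : Equiv.Perm (Fin n)) :
    (fun p => twistedAnnihFn m R Q φ Ψ n (p ∘ σ)) =ᵐ[shellPi s m n]
      twistedAnnihFn m R Q φ Ψ n := by
  filter_upwards [ae_cons (h (Equiv.Perm.decomposeFin.symm (0, σ)))] with p hp
  rw [twistedAnnihFn_eq, twistedAnnihFn_eq]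
  congr 1
  refine integral_congr_ae ?_
  filter_upwards [hp] with q hq
  rw [cons_comp_perm, hq]
  congr 2
  exact Equiv.prod_comp (Equiv.Perm.decomposeFin.symm (0, σ))
    (fun k => R (mink (act Q q) ((Fin.cons q p : Fin (n + 1) → Spacetime s) k)))

theorem symm_toLp {s : ℕ} {m : ℝ} {n : ℕ} {F : (Fin n → Spacetime s) → ℂ}
    (hF : MemLp F 2 (shellPi s m n))
    (h : ∀ σ : Equiv.Perm (Fin n), (fun p => F (p ∘ σ)) =ᵐ[shellPi s m n] F) :
    hF.toLp F ∈ nParticle s m n := fun σ =>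
  ((measurePreserving_perm s m σ).quasiMeasurePreserving.ae_eq_comp hF.coeFn_toLp).trans
    ((h σ).trans hF.coeFn_toLp.symm)

/-- The sequence of `n`-particle functions of a Fock space vector. -/
def fnOf {s : ℕ} {m : ℝ} (Ψ : Fock s m) (n : ℕ) (p : Fin n → Spacetime s) : ℂ :=
  ((Ψ n : nParticle s m n) : Lp ℂ 2 (shellPi s m n)) p

theorem memLp_fnOf {s : ℕ} {m : ℝ} (Ψ : Fock s m) (n : ℕ) :
    MemLp (fnOf Ψ n) 2 (shellPi s m n) := Lp.memLp _

theorem fnOf_symm {s : ℕ} {m : ℝ} (Ψ : Fock s m) (n : ℕ) (σ : Equiv.Perm (Fin n)) :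
    (fun p => fnOf Ψ n (p ∘ σ)) =ᵐ[shellPi s m n] fnOf Ψ n := (Ψ n).2 σ

theorem fnOf_add {s : ℕ} {m : ℝ} (Ψ Φ : Fock s m) (n : ℕ) :
    fnOf (Ψ + Φ) n =ᵐ[shellPi s m n] fun p => fnOf Ψ n p + fnOf Φ n p :=
  Lp.coeFn_add (Ψ n : Lp ℂ 2 (shellPi s m n)) (Φ n : Lp ℂ 2 (shellPi s m n))

theorem fnOf_smul {s : ℕ} {m : ℝ} (c : ℂ) (Ψ : Fock s m) (n : ℕ) :
    fnOf (c • Ψ) n =ᵐ[shellPi s m n] fun p => c * fnOf Ψ n p :=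
  Lp.coeFn_smul c (Ψ n : Lp ℂ 2 (shellPi s m n))

theorem fock_ext {s : ℕ} {m : ℝ} {Ψ Φ : Fock s m}
    (h : ∀ n, fnOf Ψ n =ᵐ[shellPi s m n] fnOf Φ n) : Ψ = Φ :=
  lp.ext (funext fun n => Subtype.ext (Lp.ext (h n)))

/-- The finite particle vector with given `n`-particle functions. -/
def fockMk {s : ℕ} {m : ℝ} (F : ∀ n, (Fin n → Spacetime s) → ℂ)
    (hF : ∀ n, MemLp (F n) 2 (shellPi s m n))
    (hs : ∀ n, ∀ σ : Equiv.Perm (Fin n), (fun p => F n (p ∘ σ)) =ᵐ[shellPi s m n] F n)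
    (hfin : ∃ N, ∀ n, N < n → F n =ᵐ[shellPi s m n] 0) : Fock s m :=
  ⟨fun n => ⟨(hF n).toLp (F n), symm_toLp (hF n) (hs n)⟩, by
    obtain ⟨N, hN⟩ := hfin
    refine (memℓp_zero ((Set.finite_le_nat N).subset fun n hn => ?_)).of_exponent_ge zero_le
    by_contra h
    refine hn (Subtype.ext (Lp.ext ?_))
    exact (hF n).coeFn_toLp.trans ((hN n (not_le.1 h)).trans (Lp.coeFn_zero ..).symm)⟩

theorem fnOf_fockMk {s : ℕ} {m : ℝ} (F : ∀ n, (Fin n → Spacetime s) → ℂ)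
    (hF : ∀ n, MemLp (F n) 2 (shellPi s m n))
    (hs : ∀ n, ∀ σ : Equiv.Perm (Fin n), (fun p => F n (p ∘ σ)) =ᵐ[shellPi s m n] F n)
    (hfin : ∃ N, ∀ n, N < n → F n =ᵐ[shellPi s m n] 0) (n : ℕ) :
    fnOf (fockMk F hF hs hfin) n =ᵐ[shellPi s m n] F n := (hF n).coeFn_toLp

theorem twistedAnnihFn_vanish {s : ℕ} {m : ℝ} (R : DeformationFunction)
    (Q : Matrix (Fin (s + 1)) (Fin (s + 1)) ℝ) (φ : Spacetime s → ℂ) (Ψ : finiteParticle s m) :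
    ∃ N, ∀ n, N < n →
      twistedAnnihFn m R Q φ (fnOf (Ψ : Fock s m)) n =ᵐ[shellPi s m n] 0 := by
  obtain ⟨N, hN⟩ := Ψ.2
  refine ⟨N, fun n hn => ?_⟩
  have h : fnOf (Ψ : Fock s m) (n + 1) =ᵐ[shellPi s m (n + 1)] fun _ => 0 := by
    have h0 := hN (n + 1) (by omega)
    have : fnOf (Ψ : Fock s m) (n + 1) =
        ((0 : nParticle s m (n + 1)) : Lp ℂ 2 (shellPi s m (n + 1))) := by
      funext p; simp only [fnOf, h0]
    rw [this]
    exact Lp.coeFn_zero ..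
  refine (twistedAnnihFn_congr (Φ := fun n _ => (0 : ℂ)) φ n h).trans
    (Filter.Eventually.of_forall fun p => ?_)
  simp [twistedAnnihFn_eq]

/-- The vector `a_{R,Q}(φ)Ψ`, for a finite particle vector `Ψ`. -/
def twistedAnnihVec {s : ℕ} {m : ℝ} (R : DeformationFunction)
    (Q : Matrix (Fin (s + 1)) (Fin (s + 1)) ℝ) (φ : Lp ℂ 2 (shellMeasure s m))
    (Ψ : finiteParticle s m) : Fock s m :=
  fockMk (twistedAnnihFn m R Q φ (fnOf (Ψ : Fock s m)))
    (fun n => memLp_twistedAnnihFn R Q (Lp.memLp φ) n (memLp_fnOf _ _))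
    (fun n => twistedAnnihFn_symm φ n (fnOf_symm _ _)) (twistedAnnihFn_vanish R Q φ Ψ)

theorem fnOf_twistedAnnihVec {s : ℕ} {m : ℝ} (R : DeformationFunction)
    (Q : Matrix (Fin (s + 1)) (Fin (s + 1)) ℝ) (φ : Lp ℂ 2 (shellMeasure s m))
    (Ψ : finiteParticle s m) (n : ℕ) :
    fnOf (twistedAnnihVec R Q φ Ψ) n =ᵐ[shellPi s m n]
      twistedAnnihFn m R Q φ (fnOf (Ψ : Fock s m)) n := fnOf_fockMk ..

theorem twistedAnnihFn_add {s : ℕ} {m : ℝ} (R : DeformationFunction)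
    (Q : Matrix (Fin (s + 1)) (Fin (s + 1)) ℝ) {φ : Spacetime s → ℂ}
    (hφ : MemLp φ 2 (shellMeasure s m)) {Ψ Φ Θ : ∀ n, (Fin n → Spacetime s) → ℂ} (n : ℕ)
    (hΨ : MemLp (Ψ (n + 1)) 2 (shellPi s m (n + 1)))
    (hΦ : MemLp (Φ (n + 1)) 2 (shellPi s m (n + 1)))
    (hΘ : Θ (n + 1) =ᵐ[shellPi s m (n + 1)] fun p => Ψ (n + 1) p + Φ (n + 1) p) :
    twistedAnnihFn m R Q φ Θ n =ᵐ[shellPi s m n]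
      fun p => twistedAnnihFn m R Q φ Ψ n p + twistedAnnihFn m R Q φ Φ n p := by
  refine (twistedAnnihFn_congr (Φ := fun n p => Ψ n p + Φ n p) φ n hΘ).trans ?_
  filter_upwards [integrable_twistedAnnihFn R Q hφ n hΨ, integrable_twistedAnnihFn R Q hφ n hΦ]
    with p h3 h4
  simp only [twistedAnnihFn_eq]
  rw [← mul_add, ← integral_add h3 h4]
  congr 2
  funext q
  rw [mul_add, mul_add]

theorem twistedAnnihFn_smul {s : ℕ} {m : ℝ} (R : DeformationFunction)
    (Q : Matrix (Fin (s + 1)) (Fin (s + 1)) ℝ) (φ : Spacetime s → ℂ)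
    {Ψ Θ : ∀ n, (Fin n → Spacetime s) → ℂ} (n : ℕ) (c : ℂ)
    (hΘ : Θ (n + 1) =ᵐ[shellPi s m (n + 1)] fun p => c * Ψ (n + 1) p) :
    twistedAnnihFn m R Q φ Θ n =ᵐ[shellPi s m n] fun p => c * twistedAnnihFn m R Q φ Ψ n p := by
  refine (twistedAnnihFn_congr (Φ := fun n p => c * Ψ n p) φ n hΘ).trans
    (Filter.Eventually.of_forall fun p => ?_)
  simp only [twistedAnnihFn_eq]
  rw [mul_left_comm c]
  congr 1
  rw [← integral_const_mul]
  congr 1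
  funext q
  ring

theorem twistedAnnihVec_add {s : ℕ} {m : ℝ} (R : DeformationFunction)
    (Q : Matrix (Fin (s + 1)) (Fin (s + 1)) ℝ) (φ : Lp ℂ 2 (shellMeasure s m))
    (Ψ Φ : finiteParticle s m) :
    twistedAnnihVec R Q φ (Ψ + Φ) = twistedAnnihVec R Q φ Ψ + twistedAnnihVec R Q φ Φ := by
  refine fock_ext fun n => ?_
  have h5 := twistedAnnihFn_add R Q (Lp.memLp φ) n (memLp_fnOf (Ψ : Fock s m) (n + 1))
    (memLp_fnOf (Φ : Fock s m) (n + 1)) (fnOf_add (Ψ : Fock s m) (Φ : Fock s m) (n + 1))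
  have e1 := fnOf_twistedAnnihVec R Q φ (Ψ + Φ) n
  have e3 := fnOf_add (twistedAnnihVec R Q φ Ψ) (twistedAnnihVec R Q φ Φ) n
  have e4 := (fnOf_twistedAnnihVec R Q φ Ψ n).add (fnOf_twistedAnnihVec R Q φ Φ n)
  exact e1.trans (h5.trans (e3.trans e4).symm)

theorem twistedAnnihVec_smul {s : ℕ} {m : ℝ} (R : DeformationFunction)
    (Q : Matrix (Fin (s + 1)) (Fin (s + 1)) ℝ) (φ : Lp ℂ 2 (shellMeasure s m)) (c : ℂ)
    (Ψ : finiteParticle s m) :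
    twistedAnnihVec R Q φ (c • Ψ) = c • twistedAnnihVec R Q φ Ψ := by
  refine fock_ext fun n => ?_
  have h5 := twistedAnnihFn_smul R Q φ n c (fnOf_smul c (Ψ : Fock s m) (n + 1))
  have e1 := fnOf_twistedAnnihVec R Q φ (c • Ψ) n
  have e3 := fnOf_smul c (twistedAnnihVec R Q φ Ψ) n
  have e4 := (fnOf_twistedAnnihVec R Q φ Ψ n).const_smul c
  exact e1.trans (h5.trans (e3.trans e4).symm)

/-- The deformed annihilation operator
`(a_{R,Q}(φ)Ψ)ₙ(p₁, …, pₙ) = √(n+1) ∫ dμ(q) conj φ(q) (T_R(Qq)Ψ)ₙ₊₁(q, p₁, …, pₙ)`,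
`φ ∈ L²(dμ)`, defined on all finite particle vectors. -/
def twistedAnnih {s : ℕ} {m : ℝ} (R : DeformationFunction)
    (Q : Matrix (Fin (s + 1)) (Fin (s + 1)) ℝ) (φ : Lp ℂ 2 (shellMeasure s m)) :
    Fock s m →ₗ.[ℂ] Fock s m where
  domain := finiteParticle s m
  toFun :=
    { toFun := twistedAnnihVec R Q φ
      map_add' := twistedAnnihVec_add R Q φ
      map_smul' := twistedAnnihVec_smul R Q φ }

/-- The deformed creation operator `a†_{R,Q}(φ) = a_{R,Q}(φ)*`. -/
def twistedCreat {s : ℕ} {m : ℝ} (R : DeformationFunction)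
    (Q : Matrix (Fin (s + 1)) (Fin (s + 1)) ℝ) (φ : Lp ℂ 2 (shellMeasure s m)) :
    Fock s m →ₗ.[ℂ] Fock s m := LinearPMap.adjoint (twistedAnnih R Q φ)

/-! ### The vectors `Ψ(f) = φ(f)Ω` of the free field -/

/-- For a function `F` of `N` momenta, the `n`-particle functions of the vector
`∫ dp₁ ⋯ dp_N F(p₁, …, p_N) φ̃(p₁) ⋯ φ̃(p_N) Ω`, where `Ω` is the Fock vacuum and `φ̃` is the free
field in momentum space, `∫ dp h(p) φ̃(p) = ∫ dμ(q) (h(q) a†(q) + h(-q) a(q))`. -/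
def fieldFn {s : ℕ} (m : ℝ) :
    ∀ N : ℕ, ((Fin N → Spacetime s) → ℂ) → ∀ n, (Fin n → Spacetime s) → ℂ
  | 0, F, 0, _ => F Fin.elim0
  | 0, _, _ + 1, _ => 0
  | N + 1, F, n, p =>
      creatInt (fun q => fieldFn m N fun x => F (Fin.cons q x)) n p +
        annihInt m (fun q => fieldFn m N fun x => F (Fin.cons (-q) x)) n p

/-- The weight `(1 + |x|)^{-K}`, with `K` such that it is integrable on the mass shell. -/
def weight {s : ℕ} (m : ℝ) (x : Spacetime s) : ℝ :=
  (1 + ‖x‖) ^ (-((shellMeasure s m).integrablePower : ℝ))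

theorem weight_nonneg {s : ℕ} (m : ℝ) (x : Spacetime s) : 0 ≤ weight m x := by
  unfold weight; positivity

theorem weight_le_one {s : ℕ} (m : ℝ) (x : Spacetime s) : weight m x ≤ 1 :=
  Real.rpow_le_one_of_one_le_of_nonpos (by linarith [norm_nonneg x]) (by simp)

theorem weight_neg {s : ℕ} (m : ℝ) (x : Spacetime s) : weight m (-x) = weight m x := by
  simp [weight]

theorem integrable_weight (s : ℕ) (m : ℝ) [Fact (0 < m)] :
    Integrable (weight m) (shellMeasure s m) :=
  (shellMeasure s m).integrable_pow_neg_integrablePower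

theorem prod_weight_cons {s n : ℕ} (m : ℝ) (q : Spacetime s) (x : Fin n → Spacetime s) :
    ∏ i, weight m ((Fin.cons q x : Fin (n + 1) → Spacetime s) i) =
      weight m q * ∏ i, weight m (x i) := by
  simp [Fin.prod_univ_succ]

theorem fieldFn_succ {s : ℕ} (m : ℝ) (N : ℕ) (F : (Fin (N + 1) → Spacetime s) → ℂ) (n : ℕ)
    (p : Fin n → Spacetime s) : fieldFn m (N + 1) F n p =
      creatInt (fun q => fieldFn m N fun x => F (Fin.cons q x)) n p +
        annihInt m (fun q => fieldFn m N fun x => F (Fin.cons (-q) x)) n p := by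
  rw [fieldFn]

theorem fieldFn_bound {s : ℕ} (m : ℝ) [Fact (0 < m)] (N : ℕ) : ∀ n : ℕ, ∃ c : ℝ, 0 ≤ c ∧
    ∀ (F : (Fin N → Spacetime s) → ℂ) (C : ℝ), 0 ≤ C → (∀ x, ‖F x‖ ≤ C * ∏ i, weight m (x i)) →
      ∀ p, ‖fieldFn m N F n p‖ ≤ C * c * ∏ i, weight m (p i) := by
  induction N with
  | zero =>
    intro n
    refine ⟨1, zero_le_one, fun F C hC hF p => ?_⟩
    cases n with
    | zero => simpa [fieldFn] using hF Fin.elim0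
    | succ n =>
      simp only [fieldFn, norm_zero]
      exact mul_nonneg (by positivity) (Finset.prod_nonneg fun _ _ => weight_nonneg _ _)
  | succ N ih =>
    intro n
    choose c hc0 hc using ih
    have slice : ∀ (F : (Fin (N + 1) → Spacetime s) → ℂ) (C : ℝ),
        (∀ x, ‖F x‖ ≤ C * ∏ i, weight m (x i)) → ∀ q x,
          ‖F (Fin.cons q x)‖ ≤ C * weight m q * ∏ i, weight m (x i) := by
      intro F C hF q x
      refine (hF _).trans (le_of_eq ?_)
      rw [prod_weight_cons, mul_assoc]
    have hann : ∀ (F : (Fin (N + 1) → Spacetime s) → ℂ) (C : ℝ), 0 ≤ C →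
        (∀ x, ‖F x‖ ≤ C * ∏ i, weight m (x i)) → ∀ p : Fin n → Spacetime s,
        ‖annihInt m (fun q => fieldFn m N fun x => F (Fin.cons (-q) x)) n p‖ ≤
          C * (√(n + 1 : ℝ) * (c (n + 1) * ∫ q, weight m q ∂shellMeasure s m)) *
            ∏ i, weight m (p i) := by
      intro F C hC hF p
      have hP : 0 ≤ ∏ i, weight m (p i) := Finset.prod_nonneg fun _ _ => weight_nonneg _ _
      have h1 : ‖∫ q, fieldFn m N (fun x => F (Fin.cons (-q) x)) (n + 1) (Fin.cons q p)
          ∂shellMeasure s m‖ ≤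
          ∫ q, (C * c (n + 1) * ∏ i, weight m (p i)) * weight m q ∂shellMeasure s m := by
        refine norm_integral_le_of_norm_le ((integrable_weight s m).const_mul _)
          (Filter.Eventually.of_forall fun q => ?_)
        refine (hc (n + 1) _ (C * weight m (-q)) (mul_nonneg hC (weight_nonneg _ _))
          (slice F C hF (-q)) _).trans ?_
        rw [prod_weight_cons, weight_neg]
        have hw := weight_nonneg m q
        have hw1 := weight_le_one m q
        have := mul_le_mul_of_nonneg_left hw1
          (mul_nonneg (mul_nonneg (mul_nonneg hC (hc0 (n + 1))) hP) hw)
        linarith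
      rw [integral_const_mul] at h1
      rw [annihInt, norm_mul, Complex.norm_real, Real.norm_of_nonneg (Real.sqrt_nonneg _)]
      refine (mul_le_mul_of_nonneg_left h1 (Real.sqrt_nonneg _)).trans (le_of_eq (by ring))
    have hI : 0 ≤ ∫ q, weight m q ∂shellMeasure s m := integral_nonneg fun _ => weight_nonneg _ _
    cases n with
    | zero =>
      refine ⟨√((0 : ℕ) + 1 : ℝ) * (c (0 + 1) * ∫ q, weight m q ∂shellMeasure s m), ?_,
        fun F C hC hF p => ?_⟩
      rotate_left
      · rw [fieldFn_succ]
        simp only [creatInt, zero_add]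
        exact hann F C hC hF p
      · exact mul_nonneg (Real.sqrt_nonneg _) (mul_nonneg (hc0 _) hI)
    | succ n =>
      refine ⟨(√(n + 1 : ℝ))⁻¹ * ((n + 1) * c n) +
        √((n + 1 : ℕ) + 1 : ℝ) * (c (n + 1 + 1) * ∫ q, weight m q ∂shellMeasure s m), ?_, fun F C hC hF p => ?_⟩
      rotate_left
      · rw [fieldFn_succ, mul_add, add_mul]
        refine (norm_add_le _ _).trans (add_le_add ?_ (hann F C hC hF p))
        rw [creatInt, norm_mul, norm_inv, Complex.norm_real,
          Real.norm_of_nonneg (Real.sqrt_nonneg _)]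
        have h2 : ‖∑ k, fieldFn m N (fun x => F (Fin.cons (p k) x)) n
            (fun i => p (k.succAbove i))‖ ≤ ∑ _k : Fin (n + 1), C * c n * ∏ i, weight m (p i) := by
          refine (norm_sum_le _ _).trans (Finset.sum_le_sum fun k _ => ?_)
          refine (hc n _ (C * weight m (p k)) (mul_nonneg hC (weight_nonneg _ _))
            (slice F C hF (p k)) _).trans (le_of_eq ?_)
          rw [Fin.prod_univ_succAbove (fun i => weight m (p i)) k]
          ring
        rw [Finset.sum_const, Finset.card_univ, Fintype.card_fin, nsmul_eq_mul] at h2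
        refine (mul_le_mul_of_nonneg_left h2 (inv_nonneg.2 (Real.sqrt_nonneg _))).trans
          (le_of_eq ?_)
        push_cast
        ring
      · have := hc0 n
        have := hc0 (n + 1 + 1)
        positivity

theorem measurable_cons (s n : ℕ) : Measurable fun z : Spacetime s × (Fin n → Spacetime s) =>
    (Fin.cons z.1 z.2 : Fin (n + 1) → Spacetime s) := by
  refine measurable_pi_lambda _ fun k => ?_
  refine Fin.cases ?_ (fun j => ?_) k
  · exact measurable_fst
  · exact (measurable_pi_apply j).comp measurable_snd

theorem measurable_fieldFn {s : ℕ} (m : ℝ) (N : ℕ) : ∀ (n : ℕ) (A : Type) [MeasurableSpace A]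
    (F : A → (Fin N → Spacetime s) → ℂ),
    Measurable (fun z : A × (Fin N → Spacetime s) => F z.1 z.2) →
      Measurable (fun z : A × (Fin n → Spacetime s) => fieldFn m N (F z.1) n z.2) := by
  induction N with
  | zero =>
    intro n A _ F hF
    cases n with
    | zero =>
      simp only [fieldFn]
      exact hF.comp (measurable_fst.prodMk measurable_const)
    | succ n =>
      simp only [fieldFn]
      exact measurable_const
  | succ N ih =>
    intro n A _ F hF
    simp only [fieldFn_succ]
    refine Measurable.add ?_ ?_
    · cases n with
      | zero => simp only [creatInt]; exact measurable_const
      | succ n =>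
        simp only [creatInt]
        refine (Finset.measurable_sum _ fun k _ => ?_).const_mul _
        have h := ih n (A × Spacetime s) (fun a x => F a.1 (Fin.cons a.2 x))
          (hF.comp ((measurable_fst.comp measurable_fst).prodMk ((measurable_cons s N).comp
            ((measurable_snd.comp measurable_fst).prodMk measurable_snd))))
        refine h.comp (f := fun z : A × (Fin (n + 1) → Spacetime s) =>
          ((z.1, z.2 k), fun i => z.2 (k.succAbove i))) ?_
        refine (measurable_fst.prodMk ((measurable_pi_apply k).comp measurable_snd)).prodMk
          (measurable_pi_lambda _ fun i => (measurable_pi_apply _).comp measurable_snd)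
    · simp only [annihInt]
      refine Measurable.const_mul ?_ _
      have h := ih (n + 1) (A × Spacetime s) (fun a x => F a.1 (Fin.cons (-a.2) x))
        (hF.comp ((measurable_fst.comp measurable_fst).prodMk ((measurable_cons s N).comp
          ((measurable_snd.comp measurable_fst).neg.prodMk measurable_snd))))
      have h2 : Measurable fun z : (A × (Fin n → Spacetime s)) × Spacetime s =>
          fieldFn m N (fun x => F z.1.1 (Fin.cons (-z.2) x)) (n + 1) (Fin.cons z.2 z.1.2) :=
        h.comp (f := fun z : (A × (Fin n → Spacetime s)) × Spacetime s =>
          ((z.1.1, z.2), (Fin.cons z.2 z.1.2 : Fin (n + 1) → Spacetime s)))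
          (((measurable_fst.comp measurable_fst).prodMk measurable_snd).prodMk
            ((measurable_cons s n).comp
              (measurable_snd.prodMk (measurable_snd.comp measurable_fst))))
      exact (h2.stronglyMeasurable.integral_prod_right).measurable

theorem fieldFn_vanish {s : ℕ} (m : ℝ) (N : ℕ) : ∀ (F : (Fin N → Spacetime s) → ℂ) (n : ℕ),
    N < n → ∀ p, fieldFn m N F n p = 0 := by
  induction N with
  | zero =>
    intro F n hn p
    obtain ⟨k, rfl⟩ := Nat.exists_eq_succ_of_ne_zero hn.ne'
    simp [fieldFn]
  | succ N ih =>
    intro F n hn p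
    obtain ⟨k, rfl⟩ := Nat.exists_eq_succ_of_ne_zero (Nat.zero_lt_of_lt hn).ne'
    have h1 : ∀ F p, fieldFn (s := s) m N F k p = 0 := fun F p => ih F k (by omega) p
    have h2 : ∀ F p, fieldFn (s := s) m N F (k + 1 + 1) p = 0 :=
      fun F p => ih F _ (by omega) p
    simp [fieldFn_succ, creatInt, annihInt, h1, h2]

theorem fieldFn_symm {s : ℕ} (m : ℝ) (N : ℕ) : ∀ (F : (Fin N → Spacetime s) → ℂ) (n : ℕ)
    (σ : Equiv.Perm (Fin n)) (p : Fin n → Spacetime s),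
    fieldFn m N F n (p ∘ σ) = fieldFn m N F n p := by
  induction N with
  | zero => intro F n σ p; cases n <;> simp [fieldFn]
  | succ N ih =>
    intro F n σ p
    rw [fieldFn_succ, fieldFn_succ]
    congr 1
    · cases n with
      | zero => simp [creatInt]
      | succ n =>
        simp only [creatInt]
        congr 1
        refine Fintype.sum_equiv σ _ _ fun k => ?_
        let τ : Equiv.Perm (Fin n) :=
          ((finSuccAboveEquiv k).trans (σ.subtypeEquiv fun a => by simp)).trans
            (finSuccAboveEquiv (σ k)).symm
        have hτ : (fun i => (p ∘ σ) (k.succAbove i)) =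
            (fun i => p ((σ k).succAbove i)) ∘ τ := by
          funext i
          have : finSuccAboveEquiv (σ k) (τ i) =
              (σ.subtypeEquiv (p := fun a => a ≠ k) (q := fun a => a ≠ σ k) fun a => by simp)
                (finSuccAboveEquiv k i) := by
            exact Equiv.apply_symm_apply (finSuccAboveEquiv (σ k)) _
          have h2 := congrArg Subtype.val this
          simp only [Equiv.subtypeEquiv_apply] at h2
          exact congrArg p h2.symm
        rw [hτ, ih]
        rfl
    · simp only [annihInt]
      congr 2
      funext q
      rw [cons_comp_perm, ih]

/-- Measurable functions of rapid enough decay in all momenta. -/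
def IsNice {s : ℕ} (m : ℝ) {N : ℕ} (F : (Fin N → Spacetime s) → ℂ) : Prop :=
  Measurable F ∧ ∃ C : ℝ, 0 ≤ C ∧ ∀ x, ‖F x‖ ≤ C * ∏ i, weight m (x i)

theorem IsNice.slice {s : ℕ} {m : ℝ} {N : ℕ} {F : (Fin (N + 1) → Spacetime s) → ℂ}
    (h : IsNice m F) (q : Spacetime s) : IsNice m fun x => F (Fin.cons q x) := by
  obtain ⟨hm, C, hC, hF⟩ := h
  refine ⟨hm.comp ((measurable_cons s N).comp (measurable_const.prodMk measurable_id)),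
    C * weight m q, mul_nonneg hC (weight_nonneg _ _), fun x => (hF _).trans (le_of_eq ?_)⟩
  rw [prod_weight_cons, mul_assoc]

theorem IsNice.fieldFn {s : ℕ} {m : ℝ} [Fact (0 < m)] {N : ℕ} {F : (Fin N → Spacetime s) → ℂ}
    (h : IsNice m F) (n : ℕ) : IsNice m (fieldFn m N F n) := by
  obtain ⟨hm, C, hC, hF⟩ := h
  obtain ⟨c, hc0, hc⟩ := fieldFn_bound (s := s) m N n
  refine ⟨?_, C * c, mul_nonneg hC hc0, hc F C hC hF⟩
  exact (measurable_fieldFn m N n Unit (fun _ => F) (hm.comp measurable_snd)).comp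
    (measurable_const (a := ()) |>.prodMk measurable_id)

theorem IsNice.integrable {s : ℕ} {m : ℝ} [Fact (0 < m)] {N : ℕ}
    {F : (Fin (N + 1) → Spacetime s) → ℂ} (h : IsNice m F) (n : ℕ) (p : Fin n → Spacetime s) :
    Integrable (fun q => DeformedField.fieldFn m N (fun x => F (Fin.cons (-q) x)) (n + 1)
      (Fin.cons q p)) (shellMeasure s m) := by
  obtain ⟨hm, C, hC, hF⟩ := h
  obtain ⟨c, hc0, hc⟩ := fieldFn_bound (s := s) m N (n + 1)
  have hmeas : Measurable fun q => DeformedField.fieldFn m N (fun x => F (Fin.cons (-q) x)) (n + 1)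
      (Fin.cons q p) := by
    have := measurable_fieldFn m N (n + 1) (Spacetime s) (fun a x => F (Fin.cons (-a) x))
      (hm.comp ((measurable_cons s N).comp (measurable_fst.neg.prodMk measurable_snd)))
    exact this.comp (measurable_id.prodMk ((measurable_cons s n).comp
      (measurable_id.prodMk measurable_const)))
  refine ((integrable_weight s m).const_mul (C * c * ∏ i, weight m (p i))).mono'
    hmeas.aestronglyMeasurable (Filter.Eventually.of_forall fun q => ?_)
  have hP : 0 ≤ ∏ i, weight m (p i) := Finset.prod_nonneg fun _ _ => weight_nonneg _ _
  refine (hc _ (C * weight m (-q)) (mul_nonneg hC (weight_nonneg _ _)) (fun x => ?_) _).trans ?_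
  · refine (hF _).trans (le_of_eq ?_)
    rw [prod_weight_cons, mul_assoc]
  · rw [prod_weight_cons, weight_neg]
    have hw := weight_nonneg m q
    have := mul_le_mul_of_nonneg_left (weight_le_one m q)
      (mul_nonneg (mul_nonneg (mul_nonneg hC hc0) hP) hw)
    linarith

theorem IsNice.memLp {s : ℕ} {m : ℝ} [Fact (0 < m)] {n : ℕ} {F : (Fin n → Spacetime s) → ℂ}
    (h : IsNice m F) : MemLp F 2 (shellPi s m n) := by
  obtain ⟨hm, C, hC, hF⟩ := h
  rw [memLp_two_iff_integrable_sq_norm hm.aestronglyMeasurable]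
  have hi : Integrable (fun p : Fin n → Spacetime s => ∏ i, weight m (p i)) (shellPi s m n) :=
    Integrable.fintype_prod fun _ => integrable_weight s m
  refine (hi.const_mul (C ^ 2)).mono' (hm.norm.pow_const 2).aestronglyMeasurable
    (Filter.Eventually.of_forall fun p => ?_)
  have hP : 0 ≤ ∏ i, weight m (p i) := Finset.prod_nonneg fun _ _ => weight_nonneg _ _
  have hP1 : ∏ i, weight m (p i) ≤ 1 :=
    Finset.prod_le_one (fun _ _ => weight_nonneg _ _) fun _ _ => weight_le_one _ _
  rw [Real.norm_of_nonneg (by positivity)]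
  refine (pow_le_pow_left₀ (norm_nonneg _) (hF p) 2).trans ?_
  rw [mul_pow]
  refine mul_le_mul_of_nonneg_left ?_ (by positivity)
  nlinarith

theorem fieldFn_add {s : ℕ} (m : ℝ) [Fact (0 < m)] (N : ℕ) :
    ∀ (F G : (Fin N → Spacetime s) → ℂ), IsNice m F → IsNice m G → ∀ n p,
      fieldFn m N (fun x => F x + G x) n p = fieldFn m N F n p + fieldFn m N G n p := by
  induction N with
  | zero => intro F G _ _ n p; cases n <;> simp [fieldFn]
  | succ N ih =>
    intro F G hF hG n p
    simp only [fieldFn_succ]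
    have hann : annihInt m (fun q => fieldFn m N fun x => F (Fin.cons (-q) x) +
        G (Fin.cons (-q) x)) n p = annihInt m (fun q => fieldFn m N fun x => F (Fin.cons (-q) x))
        n p + annihInt m (fun q => fieldFn m N fun x => G (Fin.cons (-q) x)) n p := by
      simp only [annihInt]
      rw [← mul_add, ← integral_add (hF.integrable n p) (hG.integrable n p)]
      congr 2
      funext q
      exact ih _ _ (hF.slice _) (hG.slice _) _ _
    have hcr : creatInt (fun q => fieldFn m N fun x => F (Fin.cons q x) +
        G (Fin.cons q x)) n p = creatInt (fun q => fieldFn m N fun x => F (Fin.cons q x))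
        n p + creatInt (fun q => fieldFn m N fun x => G (Fin.cons q x)) n p := by
      cases n with
      | zero => simp [creatInt]
      | succ n =>
        simp only [creatInt]
        rw [← mul_add, ← Finset.sum_add_distrib]
        congr 1
        exact Finset.sum_congr rfl fun k _ => ih _ _ (hF.slice _) (hG.slice _) _ _
    rw [hann, hcr]
    ring

theorem fieldFn_smul {s : ℕ} (m : ℝ) (N : ℕ) :
    ∀ (c : ℂ) (F : (Fin N → Spacetime s) → ℂ) (n : ℕ) (p : Fin n → Spacetime s),
      fieldFn m N (fun x => c * F x) n p = c * fieldFn m N F n p := by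
  induction N with
  | zero => intro c F n p; cases n <;> simp [fieldFn]
  | succ N ih =>
    intro c F n p
    have hann : annihInt m (fun q => fieldFn m N fun x => c * F (Fin.cons (-q) x)) n p =
        c * annihInt m (fun q => fieldFn m N fun x => F (Fin.cons (-q) x)) n p := by
      simp only [annihInt, ih]
      rw [integral_const_mul]
      ring
    have hcr : creatInt (fun q => fieldFn m N fun x => c * F (Fin.cons q x)) n p =
        c * creatInt (fun q => fieldFn m N fun x => F (Fin.cons q x)) n p := by
      cases n with
      | zero => simp [creatInt]
      | succ n =>
        simp only [creatInt, ih]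
        rw [← Finset.mul_sum]
        ring
    rw [fieldFn_succ, fieldFn_succ, hann, hcr, mul_add]

/-- The momentum space wave function of an `n`-point test function. -/
def momFn {s n : ℕ} (f : TestFn s n) (p : Fin n → Spacetime s) : ℂ :=
  momentum s n f ((tuple s n).symm p)

theorem isNice_momFn {s n : ℕ} (m : ℝ) (f : TestFn s n) : IsNice m (momFn f) := by
  refine ⟨((momentum s n f).continuous.comp (tuple s n).symm.continuous).measurable, ?_⟩
  set K := (shellMeasure s m).integrablePower with hK
  obtain ⟨C, hC⟩ : ∃ C : ℝ, ∀ y, (1 + ‖y‖) ^ (n * K) * ‖momentum s n f y‖ ≤ C := by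
    refine ⟨2 ^ (n * K) * ((Finset.Iic (n * K, 0)).sup fun m => SchwartzMap.seminorm ℝ m.1 m.2)
      (momentum s n f), fun y => ?_⟩
    have := SchwartzMap.one_add_le_sup_seminorm_apply (𝕜 := ℝ) (m := (n * K, 0)) (k := n * K)
      (n := 0) le_rfl le_rfl (momentum s n f) y
    rw [norm_iteratedFDeriv_zero] at this
    exact this
  have hC0 : 0 ≤ C := le_trans (by positivity) (hC 0)
  refine ⟨C, hC0, fun x => ?_⟩
  set y := (tuple s n).symm x with hy
  have hxy : ∀ i, ‖x i‖ ≤ ‖y‖ := fun i => by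
    refine abs_le_of_sq_le_sq' ?_ (norm_nonneg _) |>.2
    simp only [EuclideanSpace.norm_sq_eq, Fintype.sum_prod_type]
    exact Finset.single_le_sum (f := fun i => ∑ j, ‖y (i, j)‖ ^ 2)
      (fun _ _ => Finset.sum_nonneg fun _ _ => by positivity) (Finset.mem_univ i)
  have hw : ∏ i, weight m (x i) = (∏ i, (1 + ‖x i‖) ^ K)⁻¹ := by
    rw [← Finset.prod_inv_distrib]
    refine Finset.prod_congr rfl fun i _ => ?_
    rw [weight, Real.rpow_neg (by positivity), Real.rpow_natCast]
  have hle : ∏ i, (1 + ‖x i‖) ^ K ≤ (1 + ‖y‖) ^ (n * K) := by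
    refine (Finset.prod_le_prod (fun _ _ => by positivity) fun i _ =>
      pow_le_pow_left₀ (by positivity) (add_le_add_right (hxy i) 1) K).trans (le_of_eq ?_)
    simp [← pow_mul, mul_comm]
  have hpos : 0 < ∏ i, (1 + ‖x i‖) ^ K := Finset.prod_pos fun _ _ => by positivity
  rw [hw, ← div_eq_mul_inv, le_div_iff₀ hpos, mul_comm]
  exact (mul_le_mul_of_nonneg_right hle (norm_nonneg _)).trans (hC y)

/-- The vector `Ψ(f) = φ(f)Ω` for `f ∈ 𝒮_N`, where `φ` is the free field. -/
def fieldVec {s : ℕ} (m : ℝ) [Fact (0 < m)] {N : ℕ} (f : TestFn s N) : Fock s m :=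
  fockMk (fieldFn m N (momFn f)) (fun n => ((isNice_momFn m f).fieldFn n).memLp)
    (fun n σ => Filter.Eventually.of_forall fun p => fieldFn_symm m N _ n σ p)
    ⟨N, fun n hn => Filter.Eventually.of_forall fun p => fieldFn_vanish m N _ n hn p⟩

theorem fnOf_fieldVec {s : ℕ} (m : ℝ) [Fact (0 < m)] {N : ℕ} (f : TestFn s N) (n : ℕ) :
    fnOf (fieldVec m f) n =ᵐ[shellPi s m n] fieldFn m N (momFn f) n := by
  unfold fieldVec
  exact fnOf_fockMk _ _ _ _ n

theorem momFn_add {s N : ℕ} (f g : TestFn s N) :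
    momFn (f + g) = fun p => momFn f p + momFn g p := by
  funext p; simp [momFn]

theorem momFn_smul {s N : ℕ} (c : ℂ) (f : TestFn s N) :
    momFn (c • f) = fun p => c * momFn f p := by
  funext p; simp [momFn]

theorem fieldVec_add {s : ℕ} (m : ℝ) [Fact (0 < m)] {N : ℕ} (f g : TestFn s N) :
    fieldVec m (f + g) = fieldVec m f + fieldVec m g := by
  refine fock_ext fun n => ?_
  filter_upwards [fnOf_fieldVec m (f + g) n, fnOf_add (fieldVec m f) (fieldVec m g) n,
    fnOf_fieldVec m f n, fnOf_fieldVec m g n] with p h1 h2 h3 h4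
  rw [h1, h2, h3, h4, momFn_add]
  exact fieldFn_add m N _ _ (isNice_momFn m f) (isNice_momFn m g) n p

theorem fieldVec_smul {s : ℕ} (m : ℝ) [Fact (0 < m)] {N : ℕ} (c : ℂ) (f : TestFn s N) :
    fieldVec m (c • f) = c • fieldVec m f := by
  refine fock_ext fun n => ?_
  filter_upwards [fnOf_fieldVec m (c • f) n, fnOf_smul c (fieldVec m f) n,
    fnOf_fieldVec m f n] with p h1 h2 h3
  rw [h1, h2, h3, momFn_smul]
  exact fieldFn_smul m N c _ n p

/-- The linear map `f ↦ Ψ(f) = φ(f)Ω` on the Borchers-Uhlmann algebra. -/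
def gnsVec (s : ℕ) (m : ℝ) [Fact (0 < m)] : BUAlgebra s →ₗ[ℂ] Fock s m :=
  DirectSum.toModule ℂ ℕ _ fun _ =>
    { toFun := fieldVec m
      map_add' := fieldVec_add m
      map_smul' := fieldVec_smul m }

/-- The domain `𝒟 = {Ψ(g) : g}`. -/
def gnsDomain (s : ℕ) (m : ℝ) [Fact (0 < m)] : Submodule ℂ (Fock s m) :=
  LinearMap.range (gnsVec s m)

/-- The deformed field operator `φ_{R,Q}(f) : Ψ(g) ↦ Ψ(f ⊗_ρ g)`: the operator on Fock space whose
graph consists of all pairs `(Ψ(g), Ψ(f ⊗_ρ g))`. -/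
def deformedField {s : ℕ} (m : ℝ) [Fact (0 < m)] (R : DeformationFunction)
    (Q : Matrix (Fin (s + 1)) (Fin (s + 1)) ℝ) (f : BUAlgebra s) : Fock s m →ₗ.[ℂ] Fock s m :=
  (LinearMap.range ((gnsVec s m).prod (gnsVec s m ∘ₗ deformedMul R Q f))).toLinearPMap

/-- A one-point test function as an element of the Borchers-Uhlmann algebra. -/
def ofOne {s : ℕ} (f : TestFn s 1) : BUAlgebra s := DirectSum.lof ℂ ℕ (fun n => TestFn s n) 1 f

/-- The Fourier transform of a one-point test function. -/
def momOne {s : ℕ} (f : TestFn s 1) (p : Spacetime s) : ℂ := momFn f fun _ => p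

theorem memLp_momOne {s : ℕ} (m : ℝ) [Fact (0 < m)] (f : TestFn s 1) :
    MemLp (momOne f) 2 (shellMeasure s m) ∧
      MemLp (fun p => conj (momOne f (-p))) 2 (shellMeasure s m) := by
  obtain ⟨hm, C, hC, hF⟩ := isNice_momFn m f
  have hm1 : Measurable (momOne f) := hm.comp (measurable_pi_lambda _ fun _ => measurable_id)
  have hb : ∀ p, ‖momOne f p‖ ≤ C * weight m p := fun p => by
    simpa [momOne] using hF fun _ => p
  have key : ∀ h : Spacetime s → ℂ, Measurable h → (∀ p, ‖h p‖ ≤ C * weight m p) →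
      MemLp h 2 (shellMeasure s m) := fun h hh hb => by
    rw [memLp_two_iff_integrable_sq_norm hh.aestronglyMeasurable]
    refine ((integrable_weight s m).const_mul (C ^ 2)).mono'
      (hh.norm.pow_const 2).aestronglyMeasurable (Filter.Eventually.of_forall fun p => ?_)
    rw [Real.norm_of_nonneg (by positivity)]
    refine (pow_le_pow_left₀ (norm_nonneg _) (hb p) 2).trans ?_
    rw [mul_pow]
    refine mul_le_mul_of_nonneg_left ?_ (by positivity)
    nlinarith [weight_nonneg m p, weight_le_one m p]
  refine ⟨key _ hm1 hb, key _ ?_ fun p => ?_⟩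
  · exact Complex.continuous_conj.measurable.comp (hm1.comp measurable_neg)
  · rw [RCLike.norm_conj, ← weight_neg]
    exact hb _

/-- `f⁺ ∈ L²(dμ)`, the function `f⁺(p) = f̃(p)`. -/
def shellPos {s : ℕ} (m : ℝ) [Fact (0 < m)] (f : TestFn s 1) : Lp ℂ 2 (shellMeasure s m) :=
  (memLp_momOne m f).1.toLp (momOne f)

/-- `conj f⁻ ∈ L²(dμ)`, the complex conjugate of the function `f⁻(p) = f̃(-p)`. -/
def shellNegConj {s : ℕ} (m : ℝ) [Fact (0 < m)] (f : TestFn s 1) : Lp ℂ 2 (shellMeasure s m) :=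
  (memLp_momOne m f).2.toLp fun p => conj (momOne f (-p))

end DeformedField

end

noncomputable section

namespace DeformedField

/-! ### Momentum space form of the deformed product -/

/-! Since `ρ₁ = 1` and `ρ_{N+1}(q, x) = ∏ₖ ρ₂(q, xₖ) · ρ_N(x)`, the factor `ρ_N` cancels in `f ⊗_ρ
g` for a one-point `f` and an `N`-point `g`. Only the inverse cross factors remain, and by
antisymmetry of `Q` the momentum space function is `f̃(q) ∏ₖ R(-Qq·xₖ) g̃(x)`
(`momFn_deformedTensor`). Thus, for fixed `q`, deforming the product means multiplying `g̃` by one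
factor `R(v·xₖ)` per momentum, with `v = -Qq`.

Such a multiplication becomes the operator `T_R(v)` on the vector `Ψ(g)` (`fieldFn_twist`): an
uncontracted momentum keeps its factor, while a contracted pair `x, -x` contributes `R(v·x) R(-v·x)
= 1`. Applying the remaining free field in the variable `q` gives `Ψ(f ⊗_ρ g) = ∫ dμ(q) (f̃(q) a†(q)
T_R(-Qq) + f̃(-q) a(q) T_R(Qq)) Ψ(g)`, which is `fieldFn_deformedTensor`. The sign in the second
term changes because the annihilation part evaluates at `-q`.

The second term is the twisted annihilation operator by definition. The first is identified with the
Hilbert space adjoint by pairing it with an arbitrary finite particle vector (`integral_creatInt`,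
`inner_eq_inner_twistedAnnihVec`). This uses Bose symmetry, `conj R(a) = R(-a)` and `Qq·q = 0`. As
finite particle vectors are dense, the pairing determines both membership in the domain of the
adjoint and the value there.

Well-definedness of the deformed field then comes for free: `Ψ(f ⊗_ρ g)` is the value of a linear
operator at `Ψ(g)`, so it vanishes when `Ψ(g)` does (`toLinearPMap_range_prod`). -/

@[simp] theorem firstPts_apply {s k l : ℕ} (x : Config s (k + l)) (a : Fin k × Fin (s + 1)) :
    firstPts s k l x a = x (Fin.castAdd l a.1, a.2) := rfl

@[simp] theorem lastPts_apply {s k l : ℕ} (x : Config s (k + l)) (a : Fin l × Fin (s + 1)) :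
    lastPts s k l x a = x (Fin.natAdd k a.1, a.2) := rfl

theorem norm_sq_pts (s k l : ℕ) (x : Config s (k + l)) :
    ‖x‖ ^ 2 = ‖firstPts s k l x‖ ^ 2 + ‖lastPts s k l x‖ ^ 2 := by
  simp only [EuclideanSpace.norm_sq_eq, Fintype.sum_prod_type, Fin.sum_univ_add]
  rfl

/-- The isometry `ℝ^{(k+l)d} ≃ ℝ^{kd} × ℝ^{ld}`. -/
def splitPts (s k l : ℕ) : Config s (k + l) ≃ₗᵢ[ℝ] WithLp 2 (Config s k × Config s l) where
  toFun x := WithLp.toLp 2 (firstPts s k l x, lastPts s k l x)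
  invFun y := WithLp.toLp 2 fun a =>
    Fin.addCases (fun i => y.fst (i, a.2)) (fun i => y.snd (i, a.2)) a.1
  map_add' _ _ := rfl
  map_smul' _ _ := rfl
  left_inv x := by
    ext ⟨a, i⟩
    refine Fin.addCases (fun a => ?_) (fun a => ?_) a <;> simp
  right_inv y := by
    refine WithLp.ofLp_injective 2 (Prod.ext ?_ ?_) <;> ext ⟨a, i⟩ <;> simp
  norm_map' x := by
    rw [← sq_eq_sq₀ (norm_nonneg _) (norm_nonneg _), norm_sq_pts, WithLp.prod_norm_sq_eq_of_L2]
    rfl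

/-- Fubini. The splitting is an isometry onto the `L²` product, hence preserves volume, and the
volume of the `L²` product is the product measure. -/
theorem integral_firstPts_mul_lastPts {s k l : ℕ} (u : Config s k → ℂ) (v : Config s l → ℂ) :
    ∫ x, u (firstPts s k l x) * v (lastPts s k l x) = (∫ x, u x) * ∫ x, v x := by
  rw [← integral_prod_mul]
  have h := (WithLp.volume_preserving_ofLp (Config s k) (Config s l)).comp
    (splitPts s k l).measurePreserving
  exact h.integral_comp (g := fun z : Config s k × Config s l => u z.1 * v z.2)
    ((splitPts s k l).toMeasurableEquiv.trans
      (MeasurableEquiv.toLp 2 (Config s k × Config s l)).symm).measurableEmbedding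

theorem fourierNorm_add (s k l : ℕ) :
    fourierNorm s (k + l) = fourierNorm s k * fourierNorm s l := by
  rw [fourierNorm, fourierNorm, fourierNorm, ← Real.rpow_add (by positivity)]
  congr 1
  push_cast
  ring

/-- The Fourier kernel is a product over the points and the normalization is multiplicative in their
number, so both factor along the splitting. -/
theorem momentum_tensor {s k l : ℕ} (f : TestFn s k) (g : TestFn s l) (p : Config s (k + l)) :
    momentum s (k + l) (tensor s k l f g) p =
      momentum s k f (firstPts s k l p) * momentum s l g (lastPts s k l p) := by
  rw [momentum_apply, momentum_apply, momentum_apply, mul_mul_mul_comm,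
    ← integral_firstPts_mul_lastPts, ← Complex.ofReal_mul]
  congr 1
  · exact congrArg _ (fourierNorm_add s k l)
  · refine integral_congr_ae (Filter.Eventually.of_forall fun x => ?_)
    simp only [tensor_apply, Fin.prod_univ_add]
    rw [mul_mul_mul_comm]
    rfl

/-- The pairs `l < r` are separated according to whether `l = 0`. -/
theorem prod_filter_lt_succ {M : Type*} [CommMonoid M] (n : ℕ)
    (F : Fin (n + 1) → Fin (n + 1) → M) :
    ∏ lr : Fin (n + 1) × Fin (n + 1) with lr.1 < lr.2, F lr.1 lr.2 =
      (∏ k : Fin n, F 0 k.succ) *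
        ∏ lr : Fin n × Fin n with lr.1 < lr.2, F lr.1.succ lr.2.succ := by
  simp only [Finset.prod_filter, Fintype.prod_prod_type, Fin.prod_univ_succ]
  simp

/-- Pairs containing the first point give the cross factors, and the other pairs rebuild `ρ_N`. The
length `M` is kept abstract because the tensor product produces `1 + N`, which is not `N + 1` by
definition. -/
theorem rhoFn_eq {s : ℕ} (R : DeformationFunction) (Q : Matrix (Fin (s + 1)) (Fin (s + 1)) ℝ)
    {M N : ℕ} (h : M = N + 1) (q : Spacetime s) (x : Fin N → Spacetime s) :
    rhoFn R Q M ((tuple s M).symm ((Fin.cons q x : Fin (N + 1) → Spacetime s) ∘ Fin.cast h)) =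
      (∏ k, rhoTwo R Q q (x k)) * rhoFn R Q N ((tuple s N).symm x) := by
  subst h
  simp only [rhoFn, ContinuousLinearEquiv.apply_symm_apply]
  exact prod_filter_lt_succ N fun l r => rhoTwo R Q
    ((Fin.cons q x : Fin (N + 1) → Spacetime s) l) ((Fin.cons q x : Fin (N + 1) → Spacetime s) r)

theorem rhoFn_one {s : ℕ} (R : DeformationFunction) (Q : Matrix (Fin (s + 1)) (Fin (s + 1)) ℝ)
    (p : Config s 1) : rhoFn R Q 1 p = 1 := by
  refine Finset.prod_eq_one fun lr h => ?_
  exact absurd (Finset.mem_filter.1 h).2 (by omega)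

/-- The action of the deformation map on `n`-point functions. -/
def deformationFn {s : ℕ} (R : DeformationFunction) (Q : Matrix (Fin (s + 1)) (Fin (s + 1)) ℝ)
    (n : ℕ) : TestFn s n ≃ₗ[ℂ] TestFn s n :=
  ((momentum s n).trans (rhoMul R Q n)).trans (momentum s n).symm

theorem momentum_deformationFn {s n : ℕ} (R : DeformationFunction)
    (Q : Matrix (Fin (s + 1)) (Fin (s + 1)) ℝ) (f : TestFn s n) (p : Config s n) :
    momentum s n (deformationFn R Q n f) p = rhoFn R Q n p * momentum s n f p := by
  rw [deformationFn, LinearEquiv.trans_apply, LinearEquiv.apply_symm_apply]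
  exact smulLeftCLM_apply_apply (hasTemperateGrowth_rhoFn R Q n) _ _

theorem deformationMap_lof {s n : ℕ} (R : DeformationFunction)
    (Q : Matrix (Fin (s + 1)) (Fin (s + 1)) ℝ) (f : TestFn s n) :
    deformationMap R Q (DirectSum.lof ℂ ℕ (fun n => TestFn s n) n f) =
      DirectSum.lof ℂ ℕ (fun n => TestFn s n) n (deformationFn R Q n f) :=
  DFinsupp.mapRange_single (hf := fun _ => map_zero _)

/-- The deformed product of a `k`- and an `l`-point function. -/
def deformedTensor {s k l : ℕ} (R : DeformationFunction)
    (Q : Matrix (Fin (s + 1)) (Fin (s + 1)) ℝ) (f : TestFn s k) (g : TestFn s l) :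
    TestFn s (k + l) :=
  (deformationFn R Q (k + l)).symm
    (tensor s k l (deformationFn R Q k f) (deformationFn R Q l g))

theorem deformedMul_lof {s k l : ℕ} (R : DeformationFunction)
    (Q : Matrix (Fin (s + 1)) (Fin (s + 1)) ℝ) (f : TestFn s k) (g : TestFn s l) :
    deformedMul R Q (DirectSum.lof ℂ ℕ (fun n => TestFn s n) k f)
      (DirectSum.lof ℂ ℕ (fun n => TestFn s n) l g) =
      DirectSum.lof ℂ ℕ (fun n => TestFn s n) (k + l) (deformedTensor R Q f g) := by
  rw [deformedMul_apply, deformationMap_lof, deformationMap_lof, buMul_lof,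
    LinearEquiv.symm_apply_eq, deformationMap_lof, deformedTensor, LinearEquiv.apply_symm_apply]

/-- This is `ρ(f ⊗_ρ g) = ρ(f) ⊗ ρ(g)` in momentum space. With `ρ` kept on the left no inverse has
to be written. -/
theorem rhoFn_mul_momentum_deformedTensor {s k l : ℕ} (R : DeformationFunction)
    (Q : Matrix (Fin (s + 1)) (Fin (s + 1)) ℝ) (f : TestFn s k) (g : TestFn s l)
    (p : Config s (k + l)) :
    rhoFn R Q (k + l) p * momentum s (k + l) (deformedTensor R Q f g) p =
      (rhoFn R Q k (firstPts s k l p) * momentum s k f (firstPts s k l p)) *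
        (rhoFn R Q l (lastPts s k l p) * momentum s l g (lastPts s k l p)) := by
  rw [← momentum_deformationFn, ← momentum_deformationFn, ← momentum_deformationFn,
    ← momentum_tensor, deformedTensor, LinearEquiv.apply_symm_apply]

theorem prod_mul_prod_neg {ι : Type*} [Fintype ι] (R : DeformationFunction) (u : ι → ℝ) :
    (∏ k, R (u k)) * ∏ k, R (-u k) = 1 := by
  rw [← Finset.prod_mul_distrib]
  exact Finset.prod_eq_one fun _ _ => R.mul_neg _

/-- Antisymmetry moves `Q` onto the first momentum, so that the cross factors in `x` all refer to
the single vector `Qq`, as in the definition of `T_R(Qq)`. -/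
theorem mink_act_eq {s : ℕ} {Q : Matrix (Fin (s + 1)) (Fin (s + 1)) ℝ} (hQ : IsAdmissible Q)
    (q x : Spacetime s) : -mink q (act Q x) = mink (act Q q) x :=
  (hQ.antisymm q x).symm

/-- In `ρ_{1+N}(q, x) (f ⊗_ρ g)~(q, x) = ρ₁(q) f̃(q) ρ_N(x) g̃(x)` one has `ρ₁ = 1`, and `ρ_N(x)`
cancels. The cross factors are then inverted by `R(a)⁻¹ = R(-a)`. -/
theorem momFn_deformedTensor {s N : ℕ} (R : DeformationFunction)
    {Q : Matrix (Fin (s + 1)) (Fin (s + 1)) ℝ} (hQ : IsAdmissible Q) (f : TestFn s 1)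
    (g : TestFn s N) (q : Spacetime s) (x : Fin N → Spacetime s) :
    momFn (deformedTensor R Q f g)
        ((Fin.cons q x : Fin (N + 1) → Spacetime s) ∘ Fin.cast (Nat.add_comm 1 N)) =
      momOne f q * ((∏ k, R (-mink (act Q q) (x k))) * momFn g x) := by
  set p : Config s (1 + N) := (tuple s (1 + N)).symm
    ((Fin.cons q x : Fin (N + 1) → Spacetime s) ∘ Fin.cast (Nat.add_comm 1 N)) with hp
  have h1 : firstPts s 1 N p = (tuple s 1).symm fun _ => q := by
    ext ⟨a, i⟩
    obtain rfl : a = 0 := Subsingleton.elim _ _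
    rfl
  have h2 : lastPts s 1 N p = (tuple s N).symm x := by
    ext ⟨a, i⟩
    have : Fin.cast (Nat.add_comm 1 N) (Fin.natAdd 1 a) = a.succ := by
      ext; simp
    change (Fin.cons q x : Fin (N + 1) → Spacetime s)
      (Fin.cast (Nat.add_comm 1 N) (Fin.natAdd 1 a)) i = x a i
    rw [this, Fin.cons_succ]
  have h := rhoFn_mul_momentum_deformedTensor R Q f g p
  rw [h1, h2, rhoFn_one, one_mul, hp, rhoFn_eq, mul_assoc, mul_left_comm, ← hp] at h
  -- The nonvanishing factor `ρ_N(x)` occurs on both sides of `h` and is cancelled.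
  have h3 : (∏ k, rhoTwo R Q q (x k)) * momentum s (1 + N) (deformedTensor R Q f g) p =
      momOne f q * momFn g x := by
    refine mul_left_cancel₀ (rhoFn_ne_zero R Q N ((tuple s N).symm x)) ?_
    rw [← mul_assoc, mul_comm (rhoFn R Q N _), mul_assoc, mul_left_comm] at *
    simp only [momOne, momFn]
    linear_combination h
  have h4 : ∏ k, rhoTwo R Q q (x k) = ∏ k, R (mink (act Q q) (x k)) := by
    simp only [rhoTwo, mink_act_eq hQ]
  have h5 := prod_mul_prod_neg R fun k => mink (act Q q) (x k)
  rw [h4] at h3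
  change momentum s (1 + N) (deformedTensor R Q f g) p = _
  -- Multiply `h3` by the product of the `R(-Qq·xₖ)`, which by `h5` is inverse to the cross factors.
  linear_combination (∏ k, R (-mink (act Q q) (x k))) * h3 -
    momentum s (1 + N) (deformedTensor R Q f g) p * h5

/-! ### The free field and second quantized multiplication operators -/

/-- The recursion of `fieldFn` unfolds at `N + 1` momenta, whereas the deformed product with a
one-point function has `1 + N` of them. -/
theorem fieldFn_cast {s : ℕ} (m : ℝ) {M N : ℕ} (h : M = N) (F : (Fin M → Spacetime s) → ℂ)
    (n : ℕ) (p : Fin n → Spacetime s) :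
    fieldFn m M F n p = fieldFn m N (fun x => F (x ∘ Fin.cast h)) n p := by
  subst h
  rfl

theorem mink_neg_right {s : ℕ} (v x : Spacetime s) : mink v (-x) = -mink v x := by
  simp [mink]
  ring

/-- Multiplying all momenta by `R(v·x)` commutes with applying the free field to the vacuum, since
the factors of contracted momenta `x, -x` cancel. -/
theorem fieldFn_twist {s : ℕ} (m : ℝ) (R : DeformationFunction) (v : Spacetime s) (N : ℕ) :
    ∀ (F : (Fin N → Spacetime s) → ℂ) (n : ℕ) (p : Fin n → Spacetime s),
      fieldFn m N (fun x => (∏ k, R (mink v (x k))) * F x) n p = twist R v (fieldFn m N F) n p := by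
  induction N with
  | zero => intro F n p; cases n <;> simp [fieldFn, twist]
  | succ N ih =>
    intro F n p
    -- The factor of the first momentum is a constant for the inner field. The induction hypothesis
    -- turns the remaining factors into a twist.
    have hF : ∀ (q : Spacetime s) (n : ℕ) (p : Fin n → Spacetime s),
        fieldFn m N (fun x => (∏ k, R (mink v ((Fin.cons q x : Fin (N + 1) → Spacetime s) k))) *
          F (Fin.cons q x)) n p =
        R (mink v q) * twist R v (fieldFn m N fun x => F (Fin.cons q x)) n p := by
      intro q n p
      rw [← ih, ← fieldFn_smul]
      simp only [Fin.prod_univ_succ, Fin.cons_zero, Fin.cons_succ, mul_assoc]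
    rw [twist, fieldFn_succ, fieldFn_succ, mul_add]
    congr 1
    · cases n with
      | zero => simp [creatInt]
      | succ n =>
        simp only [creatInt, hF]
        rw [mul_left_comm]
        congr 1
        rw [Finset.mul_sum]
        refine Finset.sum_congr rfl fun k _ => ?_
        -- The created momentum `pₖ` supplies exactly the factor missing from the twist over the
        -- other momenta.
        rw [twist, Fin.prod_univ_succAbove _ k, mul_assoc]
    · simp only [annihInt, hF]
      rw [mul_left_comm]
      congr 1
      rw [← integral_const_mul]
      congr 1
      funext q
      -- The field is evaluated at `-q`, giving `R(-v·q)`, and the annihilated particle `q` carries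
      -- `R(v·q)` from the inner twist. Their product is `1`, leaving the twist over `p`.
      have h := R.mul_neg (mink v q)
      rw [twist, mink_neg_right, Fin.prod_univ_succ]
      simp only [Fin.cons_zero, Fin.cons_succ]
      linear_combination (∏ k, R (mink v (p k))) *
        fieldFn m N (fun x => F (Fin.cons (-q) x)) (n + 1) (Fin.cons q p) * h

theorem act_neg {s : ℕ} (Q : Matrix (Fin (s + 1)) (Fin (s + 1)) ℝ) (q : Spacetime s) :
    act Q (-q) = -act Q q := map_neg _ _

theorem mink_neg_left {s : ℕ} (v x : Spacetime s) : mink (-v) x = -mink v x := by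
  simp [mink]
  ring

/-- `Ψ(f ⊗_ρ g) = ∫ dμ(q) (f̃(q) a†(q) T_R(-Qq) + f̃(-q) a(q) T_R(Qq)) Ψ(g)`. -/
theorem fieldFn_deformedTensor {s N : ℕ} (m : ℝ) (R : DeformationFunction)
    {Q : Matrix (Fin (s + 1)) (Fin (s + 1)) ℝ} (hQ : IsAdmissible Q) (f : TestFn s 1)
    (g : TestFn s N) (n : ℕ) (p : Fin n → Spacetime s) :
    fieldFn m (1 + N) (momFn (deformedTensor R Q f g)) n p =
      creatInt (fun q n p => momOne f q * twist R (-act Q q) (fieldFn m N (momFn g)) n p) n p +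
        twistedAnnihFn m R Q (fun q => conj (momOne f (-q))) (fieldFn m N (momFn g)) n p := by
  have h : ∀ (q : Spacetime s) (n : ℕ) (p : Fin n → Spacetime s),
      fieldFn m N (fun x => momFn (deformedTensor R Q f g)
        ((Fin.cons q x : Fin (N + 1) → Spacetime s) ∘ Fin.cast (Nat.add_comm 1 N))) n p =
      momOne f q * twist R (-act Q q) (fieldFn m N (momFn g)) n p := by
    intro q n p
    rw [← fieldFn_twist, ← fieldFn_smul]
    simp only [momFn_deformedTensor R hQ, mink_neg_left]
  rw [fieldFn_cast m (Nat.add_comm 1 N), fieldFn_succ]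
  congr 1
  · cases n <;> simp only [creatInt, h]
  -- At `-q` the twist vector `-Q(-q)` is `Qq`. The two conjugations, one in the test function and
  -- one in the convention for `a_{R,Q}(φ)`, cancel.
  · simp only [twistedAnnihFn, annihInt, h, act_neg, neg_neg, Complex.conj_conj]

/-! ### Adjoint of the twisted annihilation operator -/

/-- A tensor product of square integrable functions is square integrable, and the twist only adds a
continuous factor of modulus one. -/
theorem memLp_mul_twist {s : ℕ} {m : ℝ} (R : DeformationFunction)
    (Q : Matrix (Fin (s + 1)) (Fin (s + 1)) ℝ) {φ : Spacetime s → ℂ}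
    (hφ : MemLp φ 2 (shellMeasure s m)) {Ψ : ∀ n, (Fin n → Spacetime s) → ℂ} {n : ℕ}
    (hΨ : MemLp (Ψ n) 2 (shellPi s m n)) :
    MemLp (fun z : Spacetime s × (Fin n → Spacetime s) =>
      φ z.1 * twist R (-act Q z.1) Ψ n z.2) 2 ((shellMeasure s m).prod (shellPi s m n)) := by
  have h1 : MemLp (fun z : Spacetime s × (Fin n → Spacetime s) => φ z.1 * Ψ n z.2) 2
      ((shellMeasure s m).prod (shellPi s m n)) := by
    have hm : AEStronglyMeasurable (fun z : Spacetime s × (Fin n → Spacetime s) =>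
        φ z.1 * Ψ n z.2) ((shellMeasure s m).prod (shellPi s m n)) :=
      hφ.1.comp_fst.mul hΨ.1.comp_snd
    rw [memLp_two_iff_integrable_sq_norm hm]
    have := ((memLp_two_iff_integrable_sq_norm hφ.1).1 hφ).mul_prod
      ((memLp_two_iff_integrable_sq_norm hΨ.1).1 hΨ)
    simpa only [norm_mul, mul_pow] using this
  have hc : Continuous fun z : Spacetime s × (Fin n → Spacetime s) =>
      ∏ k, R (mink (-act Q z.1) (z.2 k)) :=
    continuous_finsetProd _ fun k _ => R.continuous.comp (continuous_mink.comp
      (((continuous_act Q).comp continuous_fst).neg.prodMk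
        ((continuous_apply k).comp continuous_snd)))
  have he : (fun z : Spacetime s × (Fin n → Spacetime s) =>
      φ z.1 * twist R (-act Q z.1) Ψ n z.2) =
      fun z => (∏ k, R (mink (-act Q z.1) (z.2 k))) * (φ z.1 * Ψ n z.2) := by
    funext z
    simp only [twist]
    ring
  rw [he]
  refine h1.of_le (hc.aestronglyMeasurable.mul h1.1) (Filter.Eventually.of_forall fun z => ?_)
  rw [norm_mul, norm_prod, Finset.prod_eq_one fun k _ => R.norm_eq _, one_mul]

theorem integral_shellPi_succ {s : ℕ} {m : ℝ} {n : ℕ} {F : (Fin (n + 1) → Spacetime s) → ℂ}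
    (hF : Integrable F (shellPi s m (n + 1))) :
    ∫ p, F p ∂shellPi s m (n + 1) =
      ∫ p, ∫ q, F (Fin.cons q p) ∂shellMeasure s m ∂shellPi s m n := by
  have h := measurePreserving_cons s m n
  rw [← h.map_eq, integral_map h.measurable.aemeasurable (by rw [h.map_eq]; exact hF.1)]
  exact integral_prod_symm _ (h.integrable_comp_of_integrable hF)

theorem integral_comp_perm {s : ℕ} {m : ℝ} {n : ℕ} {F : (Fin n → Spacetime s) → ℂ}
    (hF : Integrable F (shellPi s m n)) (σ : Equiv.Perm (Fin n)) :
    ∫ p, F (p ∘ σ) ∂shellPi s m n = ∫ p, F p ∂shellPi s m n := by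
  have h := measurePreserving_perm s m σ
  rw [← integral_map (f := F) h.measurable.aemeasurable (by rw [h.map_eq]; exact hF.1), h.map_eq]

/-- By antisymmetry. Hence `T_R(Qq)` gives the factor `R(0) = 1` to the annihilated particle `q`
itself, so only the remaining particles are twisted. -/
theorem mink_act_self {s : ℕ} {Q : Matrix (Fin (s + 1)) (Fin (s + 1)) ℝ} (hQ : IsAdmissible Q)
    (q : Spacetime s) : mink (act Q q) q = 0 := by
  have h := hQ.antisymm q q
  have h2 : mink (act Q q) q = mink q (act Q q) := by
    simp only [mink, mul_comm]
  linarith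

/-- The twisted creation operator is formally adjoint to the twisted annihilation operator. -/
theorem integral_creatInt {s : ℕ} {m : ℝ} (R : DeformationFunction)
    {Q : Matrix (Fin (s + 1)) (Fin (s + 1)) ℝ} (hQ : IsAdmissible Q) {φ : Spacetime s → ℂ}
    (hφ : MemLp φ 2 (shellMeasure s m)) {Ψ Φ : ∀ n, (Fin n → Spacetime s) → ℂ} (n : ℕ)
    (hΨ : MemLp (Ψ n) 2 (shellPi s m n)) (hΦ : MemLp (Φ (n + 1)) 2 (shellPi s m (n + 1)))
    (hs : ∀ σ : Equiv.Perm (Fin (n + 1)),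
      (fun p => Φ (n + 1) (p ∘ σ)) =ᵐ[shellPi s m (n + 1)] Φ (n + 1)) :
    ∫ p, Φ (n + 1) p * conj (creatInt (fun q n p => φ q * twist R (-act Q q) Ψ n p) (n + 1) p)
        ∂shellPi s m (n + 1) =
      ∫ p, twistedAnnihFn m R Q φ Φ n p * conj (Ψ n p) ∂shellPi s m n := by
  -- `H` is the summand `k = 0` of the creation sum. All other summands are `H` with permuted
  -- arguments.
  set H : (Fin (n + 1) → Spacetime s) → ℂ := fun p =>
    φ (p 0) * twist R (-act Q (p 0)) Ψ n (fun i => p i.succ) with hH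
  have hHL : MemLp H 2 (shellPi s m (n + 1)) :=
    (memLp_mul_twist R Q hφ hΨ).comp_measurePreserving
      (measurePreserving_piFinSuccAbove (fun _ : Fin (n + 1) => shellMeasure s m) 0)
  have hint : Integrable (fun p => Φ (n + 1) p * conj (H p)) (shellPi s m (n + 1)) :=
    hΦ.integrable_mul (memLp_conj hHL)
  have hperm : ∀ σ : Equiv.Perm (Fin (n + 1)),
      (fun p => Φ (n + 1) p * conj (H (p ∘ σ))) =ᵐ[shellPi s m (n + 1)]
        fun p => Φ (n + 1) (p ∘ σ) * conj (H (p ∘ σ)) := by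
    intro σ
    filter_upwards [hs σ] with p hp
    rw [hp]
  -- The inverse of `k.cycleRange` sends `0` to `k` and `i.succ` to `k.succAbove i`, so it moves the
  -- `k`-th momentum to the front and keeps the order of the rest.
  have hterm : ∀ (k : Fin (n + 1)) (p : Fin (n + 1) → Spacetime s),
      φ (p k) * twist R (-act Q (p k)) Ψ n (fun i => p (k.succAbove i)) =
        H (p ∘ k.cycleRange.symm) := by
    intro k p
    simp only [hH, Function.comp_apply, Fin.cycleRange_symm_zero, Fin.cycleRange_symm_succ]
  have hn : (√(n + 1 : ℝ) : ℂ) ≠ 0 := by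
    rw [Complex.ofReal_ne_zero]
    positivity
  have hsq : (√(n + 1 : ℝ) : ℂ) * √(n + 1 : ℝ) = n + 1 := by
    rw [← Complex.ofReal_mul, Real.mul_self_sqrt (by positivity)]
    push_cast
    rfl
  -- By symmetry of `Φ` the `n + 1` summands have equal integrals, and `(n + 1)/√(n + 1) = √(n + 1)`
  -- is the factor of the annihilation operator.
  have hleft : ∫ p, Φ (n + 1) p *
      conj (creatInt (fun q n p => φ q * twist R (-act Q q) Ψ n p) (n + 1) p)
        ∂shellPi s m (n + 1) =
      √(n + 1 : ℝ) * ∫ p, Φ (n + 1) p * conj (H p) ∂shellPi s m (n + 1) := by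
    have h1 : ∀ p, Φ (n + 1) p *
        conj (creatInt (fun q n p => φ q * twist R (-act Q q) Ψ n p) (n + 1) p) =
        (√(n + 1 : ℝ) : ℂ)⁻¹ * ∑ k : Fin (n + 1),
          Φ (n + 1) p * conj (H (p ∘ k.cycleRange.symm)) := by
      intro p
      simp only [creatInt, hterm, map_mul, map_inv₀, Complex.conj_ofReal, map_sum,
        ← Finset.mul_sum]
      ring
    have hi : ∀ σ : Equiv.Perm (Fin (n + 1)),
        Integrable (fun p => Φ (n + 1) p * conj (H (p ∘ σ))) (shellPi s m (n + 1)) := fun σ =>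
      ((measurePreserving_perm s m σ).integrable_comp_of_integrable hint).congr (hperm σ).symm
    simp only [h1]
    rw [integral_const_mul, integral_finsetSum _ fun k _ => hi _]
    have h2 : ∀ k : Fin (n + 1), ∫ p, Φ (n + 1) p * conj (H (p ∘ k.cycleRange.symm))
        ∂shellPi s m (n + 1) = ∫ p, Φ (n + 1) p * conj (H p) ∂shellPi s m (n + 1) := fun k =>
      (integral_congr_ae (hperm _)).trans (integral_comp_perm hint k.cycleRange.symm)
    simp only [h2, Finset.sum_const, Finset.card_univ, Fintype.card_fin, nsmul_eq_mul]
    push_cast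
    rw [← hsq]
    field_simp
  rw [hleft, integral_shellPi_succ hint, ← integral_const_mul]
  refine integral_congr_ae (Filter.Eventually.of_forall fun p => ?_)
  simp only [twistedAnnihFn_eq]
  rw [mul_assoc, ← integral_mul_const]
  congr 1
  refine integral_congr_ae (Filter.Eventually.of_forall fun q => ?_)
  -- Conjugation turns `R(-Qq·pᵢ)` into `R(Qq·pᵢ)`, and the extra factor `R(Qq·q)` on the
  -- annihilation side is `1`.
  simp only [hH, twist, Fin.prod_univ_succ, Fin.cons_zero, Fin.cons_succ, mink_act_self hQ,
    R.map_zero, map_mul, map_prod, R.conj_eq, mink_neg_left, neg_neg]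
  ring

/-! ### Inner products and finite particle vectors in Fock space -/

theorem fnOf_eq_zero {s : ℕ} {m : ℝ} {Ψ : Fock s m} {n : ℕ}
    (h : fnOf Ψ n =ᵐ[shellPi s m n] 0) : Ψ n = 0 :=
  Subtype.ext (Lp.ext (h.trans (Lp.coeFn_zero ..).symm))

theorem inner_fock {s : ℕ} {m : ℝ} (Ψ Φ : Fock s m) (n : ℕ) :
    inner ℂ (Ψ n) (Φ n) = ∫ p, fnOf Φ n p * conj (fnOf Ψ n p) ∂shellPi s m n := by
  rw [Submodule.coe_inner, L2.inner_def]
  rfl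

/-- Allows passing from a class in `L²(dμ)` to the explicit test function. The equality holds at
every `p`, as `φ` enters only under the integral. -/
theorem twistedAnnihFn_congr_left {s : ℕ} {m : ℝ} {R : DeformationFunction}
    {Q : Matrix (Fin (s + 1)) (Fin (s + 1)) ℝ} {φ χ : Spacetime s → ℂ}
    (h : φ =ᵐ[shellMeasure s m] χ) (Ψ : ∀ n, (Fin n → Spacetime s) → ℂ) (n : ℕ)
    (p : Fin n → Spacetime s) :
    twistedAnnihFn m R Q φ Ψ n p = twistedAnnihFn m R Q χ Ψ n p := by
  rw [twistedAnnihFn_eq, twistedAnnihFn_eq]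
  congr 1
  refine integral_congr_ae ?_
  filter_upwards [h] with q hq
  rw [hq]

/-- The truncations of a vector to finitely many sectors converge to it. Density is what makes
`LinearPMap.adjoint` the genuine adjoint; without it the operator would take the default value zero.
-/
theorem dense_finiteParticle (s : ℕ) (m : ℝ) : Dense (finiteParticle s m : Set (Fock s m)) := by
  intro Ψ
  refine mem_closure_of_tendsto (lp.hasSum_single (by simp) Ψ)
    (Filter.Eventually.of_forall fun t => ?_)
  refine Submodule.sum_mem _ fun i _ => ⟨i, fun n hn => ?_⟩
  exact lp.single_apply_ne 2 i _ hn.ne'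

/-- Creation raises the particle number by one, so the sector `n + 1` of one inner product matches
the sector `n` of the other. -/
theorem hasSum_unique_of_shift {f g : ℕ → ℂ} {a b : ℂ} (hf : HasSum f a) (hg : HasSum g b)
    (h0 : f 0 = 0) (h : ∀ n, f (n + 1) = g n) : a = b := by
  have h1 := (hasSum_nat_add_iff' 1).2 hf
  rw [Finset.sum_range_one, h0, sub_zero] at h1
  simp only [h] at h1
  exact h1.unique hg

/-- A vector whose `n`-particle functions are those of `∫ dμ(q) φ(q) a†(q) T_R(-Qq) Ψ` is the image
of `Ψ` under the adjoint of `a_{R,Q}(φ)`. -/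
theorem inner_eq_inner_twistedAnnihVec {s : ℕ} {m : ℝ} (R : DeformationFunction)
    {Q : Matrix (Fin (s + 1)) (Fin (s + 1)) ℝ} (hQ : IsAdmissible Q)
    (φ : Lp ℂ 2 (shellMeasure s m)) {χ : Spacetime s → ℂ} (hφ : φ =ᵐ[shellMeasure s m] χ)
    {Ψ Θ : Fock s m} {G : ∀ n, (Fin n → Spacetime s) → ℂ}
    (hΨ : ∀ n, fnOf Ψ n =ᵐ[shellPi s m n] G n)
    (hΘ : ∀ n, fnOf Θ n =ᵐ[shellPi s m n]
      creatInt (fun q n p => χ q * twist R (-act Q q) G n p) n)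
    (Φ : finiteParticle s m) :
    inner ℂ Θ (Φ : Fock s m) = inner ℂ Ψ (twistedAnnihVec R Q φ Φ) := by
  -- A created vector has no vacuum component, so the unmatched term of the shifted series vanishes.
  have h0 : Θ 0 = 0 := by
    refine fnOf_eq_zero ?_
    filter_upwards [hΘ 0] with p hp
    rw [hp, creatInt, Pi.zero_apply]
  refine hasSum_unique_of_shift (lp.hasSum_inner Θ (Φ : Fock s m))
    (lp.hasSum_inner Ψ (twistedAnnihVec R Q φ Φ)) (by rw [h0, inner_zero_left]) fun n => ?_
  have hχ : MemLp χ 2 (shellMeasure s m) := (memLp_congr_ae hφ).1 (Lp.memLp φ)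
  rw [inner_fock, inner_fock]
  have h1 := integral_creatInt R hQ hχ n ((memLp_congr_ae (hΨ n)).1 (memLp_fnOf Ψ n))
    (memLp_fnOf (Φ : Fock s m) (n + 1)) (fnOf_symm (Φ : Fock s m) (n + 1))
  refine (integral_congr_ae ?_).trans (h1.trans (integral_congr_ae ?_))
  · filter_upwards [hΘ (n + 1)] with p hp
    rw [hp]
  · filter_upwards [hΨ n, fnOf_twistedAnnihVec R Q φ Φ n] with p hp hp2
    rw [hp, hp2, twistedAnnihFn_congr_left hφ]

/-! ### Partially defined operators -/

/-- A vector `w` representing the functional `x ↦ ⟨y, T x⟩` shows its boundedness, hence domain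
membership. Density makes `w` unique. -/
theorem exists_adjoint_eq {E F : Type*} [NormedAddCommGroup E] [InnerProductSpace ℂ E]
    [NormedAddCommGroup F] [InnerProductSpace ℂ F] [CompleteSpace E] {T : E →ₗ.[ℂ] F}
    (hT : Dense (T.domain : Set E)) {y : F} {w : E}
    (h : ∀ x : T.domain, inner ℂ w (x : E) = inner ℂ y (T x)) :
    ∃ hy : y ∈ T.adjoint.domain, T.adjoint ⟨y, hy⟩ = w :=
  ⟨T.mem_adjoint_domain_of_exists y ⟨w, h⟩, LinearPMap.adjoint_apply_eq hT _ h⟩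

/-- A sum of partially defined operators, evaluated along a linear map on a direct sum, is
determined by its values on homogeneous elements. -/
theorem linearPMap_eq_add_of_lof {E : Type*} [AddCommGroup E] [Module ℂ E] {V : ℕ → Type*}
    [∀ n, AddCommGroup (V n)] [∀ n, Module ℂ (V n)] (Ψ Φ : DirectSum ℕ V →ₗ[ℂ] E)
    (A B : E →ₗ.[ℂ] E)
    (key : ∀ (n : ℕ) (v : V n), ∃ (h₁ : Ψ (DirectSum.lof ℂ ℕ V n v) ∈ A.domain)
      (h₂ : Ψ (DirectSum.lof ℂ ℕ V n v) ∈ B.domain),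
      Φ (DirectSum.lof ℂ ℕ V n v) = A ⟨_, h₁⟩ + B ⟨_, h₂⟩) (g : DirectSum ℕ V) :
    ∃ (h₁ : Ψ g ∈ A.domain) (h₂ : Ψ g ∈ B.domain), Φ g = A ⟨_, h₁⟩ + B ⟨_, h₂⟩ := by
  induction g using DirectSum.induction_on with
  | zero =>
    simp only [map_zero]
    refine ⟨A.domain.zero_mem, B.domain.zero_mem, ?_⟩
    rw [show (⟨0, A.domain.zero_mem⟩ : A.domain) = 0 from rfl,
      show (⟨0, B.domain.zero_mem⟩ : B.domain) = 0 from rfl, A.map_zero, B.map_zero, add_zero]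
  | of n v => exact key n v
  | add g g' ihg ihg' =>
    obtain ⟨h₁, h₂, e⟩ := ihg
    obtain ⟨h₁', h₂', e'⟩ := ihg'
    simp only [map_add]
    refine ⟨A.domain.add_mem h₁ h₁', B.domain.add_mem h₂ h₂', ?_⟩
    rw [e, e', add_add_add_comm, ← A.map_add, ← B.map_add]
    rfl

/-- If `A + B` maps `Ψ g` to `Φ g`, then the operator with graph `{(Ψ g, Φ g)}` is well defined and
is the restriction of `A + B` to the range of `Ψ`. -/
theorem toLinearPMap_range_prod {V E : Type*} [AddCommGroup V] [Module ℂ V]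
    [AddCommGroup E] [Module ℂ E] (Ψ Φ : V →ₗ[ℂ] E) (A B : E →ₗ.[ℂ] E)
    (key : ∀ g, ∃ (h₁ : Ψ g ∈ A.domain) (h₂ : Ψ g ∈ B.domain),
      Φ g = A ⟨_, h₁⟩ + B ⟨_, h₂⟩) :
    (LinearMap.range (Ψ.prod Φ)).toLinearPMap.domain = LinearMap.range Ψ ∧
      (∀ g, ∃ h : Ψ g ∈ (LinearMap.range (Ψ.prod Φ)).toLinearPMap.domain,
        (LinearMap.range (Ψ.prod Φ)).toLinearPMap ⟨Ψ g, h⟩ = Φ g) ∧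
      LinearMap.range Ψ ≤ A.domain ∧ LinearMap.range Ψ ≤ B.domain ∧
      (LinearMap.range (Ψ.prod Φ)).toLinearPMap = (A + B).domRestrict (LinearMap.range Ψ) := by
  have hA : LinearMap.range Ψ ≤ A.domain := by
    rintro _ ⟨g, rfl⟩
    exact (key g).1
  have hB : LinearMap.range Ψ ≤ B.domain := by
    rintro _ ⟨g, rfl⟩
    exact (key g).2.1
  -- The graph is single-valued: if `Ψ g = 0`, then `Φ g = A 0 + B 0 = 0`.
  have hfun : ∀ x ∈ LinearMap.range (Ψ.prod Φ), x.1 = 0 → x.2 = 0 := by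
    rintro _ ⟨g, rfl⟩ hx
    obtain ⟨h₁, h₂, e⟩ := key g
    refine e.trans ?_
    rw [show (⟨_, h₁⟩ : A.domain) = 0 from Subtype.ext hx,
      show (⟨_, h₂⟩ : B.domain) = 0 from Subtype.ext hx, A.map_zero, B.map_zero, add_zero]
  have hdom : (LinearMap.range (Ψ.prod Φ)).toLinearPMap.domain = LinearMap.range Ψ := by
    rw [Submodule.toLinearPMap_domain, ← LinearMap.range_comp, LinearMap.fst_prod]
  have happ : ∀ g, ∃ h : Ψ g ∈ (LinearMap.range (Ψ.prod Φ)).toLinearPMap.domain,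
      (LinearMap.range (Ψ.prod Φ)).toLinearPMap ⟨Ψ g, h⟩ = Φ g := by
    intro g
    have h : Ψ g ∈ (LinearMap.range (Ψ.prod Φ)).toLinearPMap.domain := hdom ▸ ⟨g, rfl⟩
    refine ⟨h, ?_⟩
    -- The value chosen by `toLinearPMap` and `Φ g` both lie over `Ψ g` in the graph. Their
    -- difference lies over `0`, so it vanishes.
    have h1 := Submodule.mem_graph_toLinearPMap hfun ⟨Ψ g, h⟩
    have h2 : (Ψ g, Φ g) ∈ LinearMap.range (Ψ.prod Φ) := ⟨g, rfl⟩
    exact sub_eq_zero.1 (hfun _ (Submodule.sub_mem _ h1 h2) (sub_self _))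
  refine ⟨hdom, happ, hA, hB, LinearPMap.ext ?_ ?_⟩
  · rw [hdom, LinearPMap.domRestrict_domain, LinearPMap.add_domain,
      inf_eq_left.2 (le_inf hA hB)]
  · intro x hx hx'
    obtain ⟨g, rfl⟩ : x ∈ LinearMap.range Ψ := hdom ▸ hx
    obtain ⟨_, e⟩ := happ g
    obtain ⟨h₁, h₂, e'⟩ := key g
    rw [e, e']
    exact (LinearPMap.domRestrict_apply (f := A + B) (y := ⟨Ψ g, h₁, h₂⟩) rfl).symm

/-! ### The deformed field operators -/

theorem fieldVec_mem_finiteParticle {s : ℕ} (m : ℝ) [Fact (0 < m)] {N : ℕ} (g : TestFn s N) :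
    fieldVec m g ∈ finiteParticle s m :=
  ⟨N, fun n hn => fnOf_eq_zero ((fnOf_fieldVec m g n).trans
    (Filter.Eventually.of_forall fun p => fieldFn_vanish m N _ n hn p))⟩

/-- The `n`-particle functions of the creation part of the deformed field. -/
theorem fnOf_creatInt_of_add_eq {s : ℕ} {m : ℝ} [Fact (0 < m)] (R : DeformationFunction)
    {Q : Matrix (Fin (s + 1)) (Fin (s + 1)) ℝ} (hQ : IsAdmissible Q) (f : TestFn s 1) {N : ℕ}
    (g : TestFn s N) (Φ : finiteParticle s m) (hΦ : (Φ : Fock s m) = fieldVec m g) (Θ : Fock s m)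
    (h : Θ + twistedAnnihVec R Q (shellNegConj m f) Φ = fieldVec m (deformedTensor R Q f g))
    (n : ℕ) :
    fnOf Θ n =ᵐ[shellPi s m n] creatInt (fun q n p =>
      momOne f q * twist R (-act Q q) (fieldFn m N (momFn g)) n p) n := by
  have e1 := fnOf_add Θ (twistedAnnihVec R Q (shellNegConj m f) Φ) n
  rw [h] at e1
  have e2 : fnOf (Φ : Fock s m) (n + 1) =ᵐ[shellPi s m (n + 1)]
      fieldFn m N (momFn g) (n + 1) := by
    rw [hΦ]
    exact fnOf_fieldVec m g (n + 1)
  have e3 := twistedAnnihFn_congr (R := R) (Q := Q) (shellNegConj m f) n e2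
  have e4 : ∀ p, twistedAnnihFn m R Q (shellNegConj m f) (fieldFn m N (momFn g)) n p =
      twistedAnnihFn m R Q (fun q => conj (momOne f (-q))) (fieldFn m N (momFn g)) n p :=
    twistedAnnihFn_congr_left (memLp_momOne m f).2.coeFn_toLp _ n
  filter_upwards [e1, fnOf_fieldVec m (deformedTensor R Q f g) n,
    fnOf_twistedAnnihVec R Q (shellNegConj m f) Φ n, e3] with p h1 h2 h3 h5
  -- The explicit formula has the same annihilation part as `h`; cancelling it leaves the creation
  -- part.
  have h6 := fieldFn_deformedTensor m R hQ f g n p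
  exact add_right_cancel (h1.symm.trans (h2.trans (h6.trans
    (congrArg _ ((h3.trans (h5.trans (e4 p))).symm)))))

/-- On `φ(g)Ω`, the deformed field is the sum of the twisted creation and annihilation
operators. -/
theorem deformed_fieldVec {s : ℕ} {m : ℝ} [Fact (0 < m)] (R : DeformationFunction)
    {Q : Matrix (Fin (s + 1)) (Fin (s + 1)) ℝ} (hQ : IsAdmissible Q) (f : TestFn s 1) {N : ℕ}
    (g : TestFn s N) :
    ∃ (h₁ : fieldVec m g ∈ (twistedCreat R Q (shellPos m f)).domain)
      (h₂ : fieldVec m g ∈ (twistedAnnih R Q (shellNegConj m f)).domain),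
      fieldVec m (deformedTensor R Q f g) = twistedCreat R Q (shellPos m f) ⟨_, h₁⟩ +
        twistedAnnih R Q (shellNegConj m f) ⟨_, h₂⟩ := by
  have h₂ := fieldVec_mem_finiteParticle m g
  -- The creation part is defined as the difference of two known Fock vectors, so its square
  -- integrability and symmetry need no separate proof.
  obtain ⟨Θ, h⟩ : ∃ Θ, Θ + twistedAnnihVec R Q (shellNegConj m f) ⟨_, h₂⟩ =
      fieldVec m (deformedTensor R Q f g) := ⟨_, sub_add_cancel _ _⟩
  have hinner : ∀ Φ : (twistedAnnih R Q (shellPos m f)).domain,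
      inner ℂ Θ (Φ : Fock s m) = inner ℂ (fieldVec m g) (twistedAnnih R Q (shellPos m f) Φ) :=
    inner_eq_inner_twistedAnnihVec R hQ (shellPos m f) (memLp_momOne m f).1.coeFn_toLp
      (fnOf_fieldVec m g) (fnOf_creatInt_of_add_eq R hQ f g ⟨_, h₂⟩ rfl Θ h)
  have hadj : ∃ h₁ : fieldVec m g ∈ (twistedCreat R Q (shellPos m f)).domain,
      twistedCreat R Q (shellPos m f) ⟨_, h₁⟩ = Θ :=
    exists_adjoint_eq (T := twistedAnnih R Q (shellPos m f)) (dense_finiteParticle s m) hinner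
  obtain ⟨h₁, e⟩ := hadj
  exact ⟨h₁, h₂, h.symm.trans (congrArg
    (fun Θ => Θ + twistedAnnihVec R Q (shellNegConj m f) ⟨_, h₂⟩) e.symm)⟩

theorem gnsVec_lof {s : ℕ} (m : ℝ) [Fact (0 < m)] {N : ℕ} (g : TestFn s N) :
    gnsVec s m (DirectSum.lof ℂ ℕ (fun n => TestFn s n) N g) = fieldVec m g :=
  DirectSum.toModule_lof ..

theorem deformed_gnsVec_lof {s : ℕ} {m : ℝ} [Fact (0 < m)] (R : DeformationFunction)
    {Q : Matrix (Fin (s + 1)) (Fin (s + 1)) ℝ} (hQ : IsAdmissible Q) (f : TestFn s 1)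
    {N : ℕ} (g : TestFn s N) :
    ∃ (h₁ : gnsVec s m (DirectSum.lof ℂ ℕ (fun n => TestFn s n) N g) ∈
        (twistedCreat R Q (shellPos m f)).domain)
      (h₂ : gnsVec s m (DirectSum.lof ℂ ℕ (fun n => TestFn s n) N g) ∈
        (twistedAnnih R Q (shellNegConj m f)).domain),
      (gnsVec s m ∘ₗ deformedMul R Q (ofOne f))
        (DirectSum.lof ℂ ℕ (fun n => TestFn s n) N g) =
        twistedCreat R Q (shellPos m f) ⟨_, h₁⟩ +
          twistedAnnih R Q (shellNegConj m f) ⟨_, h₂⟩ := by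
  have h := deformed_fieldVec (m := m) R hQ f g
  have e : (gnsVec s m ∘ₗ deformedMul R Q (ofOne f))
        (DirectSum.lof ℂ ℕ (fun n => TestFn s n) N g) = fieldVec m (deformedTensor R Q f g) := by
    rw [LinearMap.comp_apply, ofOne, deformedMul_lof, gnsVec_lof]
  rw [e]
  simp only [gnsVec_lof m g]
  exact h

/-- The deformed field is the sum of the twisted creation and annihilation operators on the vectors
`φ(g)Ω`. -/
theorem deformed_gnsVec {s : ℕ} {m : ℝ} [Fact (0 < m)] (R : DeformationFunction)
    {Q : Matrix (Fin (s + 1)) (Fin (s + 1)) ℝ} (hQ : IsAdmissible Q) (f : TestFn s 1)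
    (g : BUAlgebra s) :
    ∃ (h₁ : gnsVec s m g ∈ (twistedCreat R Q (shellPos m f)).domain)
      (h₂ : gnsVec s m g ∈ (twistedAnnih R Q (shellNegConj m f)).domain),
      (gnsVec s m ∘ₗ deformedMul R Q (ofOne f)) g =
        twistedCreat R Q (shellPos m f) ⟨_, h₁⟩ +
          twistedAnnih R Q (shellNegConj m f) ⟨_, h₂⟩ := by
  refine linearPMap_eq_add_of_lof (gnsVec s m) (gnsVec s m ∘ₗ deformedMul R Q (ofOne f))
    (twistedCreat R Q (shellPos m f)) (twistedAnnih R Q (shellNegConj m f)) (fun _ g =>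
      deformed_gnsVec_lof R hQ f g) g

end DeformedField

theorem mainTheorem10 {s : ℕ} (hs : Odd s) {m : ℝ} [Fact (0 < m)]
    (R : DeformedField.DeformationFunction) (Q : Matrix (Fin (s + 1)) (Fin (s + 1)) ℝ)
    (hQ : DeformedField.IsAdmissible Q) (f : DeformedField.TestFn s 1) :
    (DeformedField.deformedField m R Q (DeformedField.ofOne f)).domain =
        DeformedField.gnsDomain s m ∧
      (∀ g : DeformedField.BUAlgebra s,
        ∃ h : DeformedField.gnsVec s m g ∈
            (DeformedField.deformedField m R Q (DeformedField.ofOne f)).domain,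
          DeformedField.deformedField m R Q (DeformedField.ofOne f)
              ⟨DeformedField.gnsVec s m g, h⟩ =
            DeformedField.gnsVec s m
              (DeformedField.deformedMul R Q (DeformedField.ofOne f) g)) ∧
      DeformedField.gnsDomain s m ≤
        (DeformedField.twistedCreat R Q (DeformedField.shellPos m f)).domain ∧
      DeformedField.gnsDomain s m ≤
        (DeformedField.twistedAnnih R Q (DeformedField.shellNegConj m f)).domain ∧
      DeformedField.deformedField m R Q (DeformedField.ofOne f) =
        (DeformedField.twistedCreat R Q (DeformedField.shellPos m f) +
          DeformedField.twistedAnnih R Q (DeformedField.shellNegConj m f)).domRestrict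
            (DeformedField.gnsDomain s m) :=
  -- The deformed field is by definition the operator with graph `{(Ψ(g), Ψ(f ⊗_ρ g))}`, so the
  -- abstract statement on such graphs applies directly.
  DeformedField.toLinearPMap_range_prod (DeformedField.gnsVec s m)
    (DeformedField.gnsVec s m ∘ₗ DeformedField.deformedMul R Q (DeformedField.ofOne f))
    (DeformedField.twistedCreat R Q (DeformedField.shellPos m f))
    (DeformedField.twistedAnnih R Q (DeformedField.shellNegConj m f))
    (DeformedField.deformed_gnsVec R hQ f)

end
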